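/- For integers $r,s\ge 0$ let $\mathbb R^{r,s}$ be $\mathbb R^{r+s}$ with the scalar product $\langle Z,W\rangle_{r,s}=\sum_{i=1}^r z_iw_i-\sum_{j=1}^s z_{r+j}w_{r+j}$, and let $\mathrm{Cl}(\mathbb R^{r,s})$ be its Clifford algebra with the convention $Z^2=-\langle Z,Z\rangle_{r,s}$. An admissible module is a non-zero finite-dimensional real representation space $\mathfrak v$ of $\mathrm{Cl}(\mathbb R^{r,s})$, with Clifford multiplication $J_Z:\mathfrak v\to\mathfrak v$ for $Z\in\mathbb R^{r,s}$, together with a non-degenerate symmetric bilinear form $\langle\cdot,\cdot\rangle_{\mathfrak v}$ for which every $J_Z$ is skew-symmetric; it is minimal if $\dim\mathfrak v$ is the least possible among all admissible modules of $\mathrm{Cl}(\mathbb R^{r,s})$. A pseudo $H$-type group $N_{r,s}$ is the connected simply connected Lie group with Lie algebra $\mathfrak n_{r,s}=\mathbb R^{r,s}\oplus\mathfrak v$ (orthogonal sum), where $\mathfrak v$ is a minimal admissible module of $\mathrm{Cl}(\mathbb R^{r,s})$, $\mathbb R^{r,s}$ is central and $[X,Y]\in\mathbb R^{r,s}$ is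 given by $\langle [X,Y],Z\rangle_{r,s}=\langle J_ZX,Y\rangle_{\mathfrak v}$ for $X,Y\in\mathfrak v$ and $Z\in\mathbb R^{r,s}$; it carries the left-invariant pseudo-Riemannian metric defined by the scalar product $\langle\cdot,\cdot\rangle_{r,s}+\langle\cdot,\cdot\rangle_{\mathfrak v}$ of $\mathfrak n_{r,s}$. The group $N_{r,s}$ is called geodesic orbit if for every $\xi\in\mathfrak n_{r,s}$ the geodesic $\gamma$ with $\gamma(0)=e$ and $\gamma'(0)=\xi$ is the orbit of $e$ under a one-parameter group $\{\varphi_t\}$ of isometries of $N_{r,s}$, up to reparametrization: $\varphi_t(e)=\gamma(l(t))$ for all $t\in\mathbb R$, where $l$ is a diffeomorphism of $\mathbb R$ onto an open interval with $l(0)=0$. **Theorem.** Let $r,s\ge 0$ and $(\mu,\nu)\in\{(8,0),(0,8),(4,4)\}$. If a pseudo $H$-type group $N_{r,s}$ is not geodesic orbit, then no pseudo $H$-type group $N_{r+\mu,s+\nu}$ is geodesic orbit. (Both groups are built on arbitrary minimal admissible modules.) -/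

import Mathlib

open scoped ContDiff

noncomputable section

/-! ### Pseudo-Riemannian geometry of a vector space, in its global chart

A (pseudo-Riemannian) metric on the manifold `E` is given by a function `g : E → E → E → ℝ`,
where `g p u w` is the scalar product of the tangent vectors `u`, `w` at the point `p`. -/

section Geometry

variable {E : Type*} [NormedAddCommGroup E] [NormedSpace ℝ E]

/-- Christoffel symbol of the first kind of the Levi-Civita connection of `g` at `p`:
`Γ(u, v; w) = (D_u g(v, w) + D_v g(u, w) - D_w g(u, v)) / 2` for constant fields `u, v, w`. -/
def christoffelFirst (g : E → E → E → ℝ) (p u v w : E) : ℝ :=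
  (fderiv ℝ (fun q => g q v w) p u + fderiv ℝ (fun q => g q u w) p v
    - fderiv ℝ (fun q => g q u v) p w) / 2

/-- `γ : ℝ → E` is a geodesic (defined on the whole line) of `g`: the geodesic equation
`∇_{γ'} γ' = 0`, paired with an arbitrary tangent vector `w`. -/
def IsGeodesicCurve (g : E → E → E → ℝ) (γ : ℝ → E) : Prop :=
  ContDiff ℝ ∞ γ ∧
    ∀ t w, g (γ t) (deriv (deriv γ) t) w + christoffelFirst g (γ t) (deriv γ t) (deriv γ t) w = 0

/-- `φ` is a smooth one-parameter group of isometries of `(E, g)`. -/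
structure IsOneParameterIsometryGroup (g : E → E → E → ℝ) (φ : ℝ → E → E) : Prop where
  smooth : ContDiff ℝ ∞ (fun x : ℝ × E => φ x.1 x.2)
  zero : ∀ p, φ 0 p = p
  add : ∀ t t' p, φ (t + t') p = φ t (φ t' p)
  isometry : ∀ t p u w, g (φ t p) (fderiv ℝ (φ t) p u) (fderiv ℝ (φ t) p w) = g p u w

/-- `l` is a diffeomorphism of `ℝ` onto an open interval with `l 0 = 0`. -/
structure IsReparametrization (l : ℝ → ℝ) : Prop where
  smooth : ContDiff ℝ ∞ l
  zero : l 0 = 0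
  deriv_ne_zero : ∀ t, deriv l t ≠ 0

/-- The curve `γ` is, up to a reparametrization, the orbit of the point `γ 0` under
a one-parameter group of isometries of `(E, g)`. -/
def IsHomogeneousCurve (g : E → E → E → ℝ) (γ : ℝ → E) : Prop :=
  ∃ φ l, IsOneParameterIsometryGroup g φ ∧ IsReparametrization l ∧ ∀ t, φ t (γ 0) = γ (l t)

/-- For a homogeneous metric `g` and a base point `o`, the geodesic orbit property: for every
initial vector `ξ`, the geodesic through `o` with the initial vector `ξ` is an orbit
of a one-parameter group of isometries. -/
def IsGeodesicOrbitAt (g : E → E → E → ℝ) (o : E) : Prop :=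
  ∀ ξ : E, ∃ γ : ℝ → E, IsGeodesicCurve g γ ∧ γ 0 = o ∧ deriv γ 0 = ξ ∧ IsHomogeneousCurve g γ

end Geometry

/-! ### Admissible Clifford modules -/

/-- The vector space `ℝ^{r,s}`: the first `r` coordinates are the positive ones. -/
abbrev PseudoEuclidean (r s : ℕ) : Type := Fin r ⊕ Fin s → ℝ

/-- The scalar product of `ℝ^{r,s}`. -/
def pseudoInner (r s : ℕ) : LinearMap.BilinForm ℝ (PseudoEuclidean r s) :=
  LinearMap.mk₂ ℝ
    (fun Z W => ∑ i, Z (Sum.inl i) * W (Sum.inl i) - ∑ j, Z (Sum.inr j) * W (Sum.inr j))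
    (fun Z Z' W => by simp only [Pi.add_apply, add_mul, Finset.sum_add_distrib]; ring)
    (fun c Z W => by
      simp only [Pi.smul_apply, smul_eq_mul, mul_assoc, ← Finset.mul_sum]; ring)
    (fun Z W W' => by simp only [Pi.add_apply, mul_add, Finset.sum_add_distrib]; ring)
    (fun c Z W => by
      simp only [Pi.smul_apply, smul_eq_mul, mul_left_comm _ c, ← Finset.mul_sum]; ring)

/-- The Clifford algebra of `ℝ^{r,s}`, with the convention `Z * Z = -⟨Z, Z⟩`. -/
abbrev PseudoClifford (r s : ℕ) : Type :=
  CliffordAlgebra (-(LinearMap.BilinMap.toQuadraticMap (pseudoInner r s)))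

/-- The structure of an admissible module on the real vector space `V`: a representation of
the Clifford algebra of `ℝ^{r,s}` and a scalar product on `V` for which the Clifford
multiplication by every vector of `ℝ^{r,s}` is skew-symmetric. -/
structure AdmissibleModule (r s : ℕ) (V : Type*) [AddCommGroup V] [Module ℝ V] where
  rep : PseudoClifford r s →ₐ[ℝ] Module.End ℝ V
  form : LinearMap.BilinForm ℝ V
  form_symm : form.IsSymm
  form_nondegenerate : form.Nondegenerate
  skew : ∀ (Z : PseudoEuclidean r s) (X Y : V),
    form (rep (CliffordAlgebra.ι _ Z) X) Y = -form X (rep (CliffordAlgebra.ι _ Z) Y)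

namespace AdmissibleModule

section Algebra

variable {r s : ℕ} {V : Type*} [AddCommGroup V] [Module ℝ V] (M : AdmissibleModule r s V)

/-- `M` is a minimal admissible module: it is non-zero, and its dimension is the least one among
all non-zero (finite-dimensional) admissible modules of the same Clifford algebra. -/
def IsMinimal (_M : AdmissibleModule r s V) : Prop :=
  Nontrivial V ∧ ∀ m : ℕ, 0 < m → Nonempty (AdmissibleModule r s (Fin m → ℝ)) →
    Module.finrank ℝ V ≤ m

/-- The operator `J_Z` on `V`. -/
def J : PseudoEuclidean r s →ₗ[ℝ] Module.End ℝ V :=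
  M.rep.toLinearMap ∘ₗ CliffordAlgebra.ι _

theorem J_sq (Z : PseudoEuclidean r s) (X : V) :
    M.J Z (M.J Z X) = -(pseudoInner r s Z Z) • X := by
  have h : M.rep (CliffordAlgebra.ι _ Z * CliffordAlgebra.ι _ Z) X
      = M.rep (algebraMap ℝ _ (-(pseudoInner r s Z Z))) X := by
    rw [CliffordAlgebra.ι_sq_scalar]; simp
  rw [map_mul, AlgHom.commutes, Module.algebraMap_end_apply] at h
  exact h

/-- The commutator `[X, Y] ∈ ℝ^{r,s}` of `X, Y ∈ V`; it is characterized by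
`⟨[X, Y], Z⟩ = ⟨J_Z X, Y⟩`, see `pseudoInner_bracket`. -/
def bracket : V →ₗ[ℝ] V →ₗ[ℝ] PseudoEuclidean r s :=
  LinearMap.mk₂ ℝ
    (fun X Y i => Sum.elim (fun _ => (1 : ℝ)) (fun _ => -1) i * M.form (M.J (Pi.single i 1) X) Y)
    (fun X X' Y => by ext i; simp [mul_add])
    (fun c X Y => by ext i; simp [mul_left_comm])
    (fun X Y Y' => by ext i; simp [mul_add])
    (fun c X Y => by ext i; simp [mul_left_comm])

theorem pseudoInner_bracket (X Y : V) (Z : PseudoEuclidean r s) :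
    pseudoInner r s (M.bracket X Y) Z = M.form (M.J Z X) Y := by
  have hZ : Z = ∑ i, Z i • (Pi.single i (1 : ℝ) : PseudoEuclidean r s) := by
    ext j; simp [Finset.sum_apply, Pi.single_apply]
  conv_rhs => rw [hZ]
  simp only [Fintype.sum_sum_type]
  simp [pseudoInner, bracket, mul_comm, sub_eq_add_neg]

theorem bracket_self (X : V) : M.bracket X X = 0 := by
  ext i
  have h := M.skew (Pi.single i 1) X X
  have h' := M.form_symm.eq X (M.rep (CliffordAlgebra.ι _ (Pi.single i 1)) X)
  have h0 : M.form (M.J (Pi.single i 1) X) X = 0 := by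
    simp only [J, LinearMap.comp_apply, AlgHom.toLinearMap_apply]
    linarith
  simp [bracket, h0]

/-- The scalar product of the pseudo `H`-type Lie algebra `ℝ^{r,s} ⊕ V`, an orthogonal sum. -/
def scalarProduct (u w : PseudoEuclidean r s × V) : ℝ :=
  pseudoInner r s u.1 w.1 + M.form u.2 w.2

/-- The product of the connected simply connected 2-step nilpotent Lie group whose Lie algebra is
`ℝ^{r,s} ⊕ V` with the commutator `[(Z, X), (W, Y)] = ([X, Y], 0)`. The group is identified with
the Lie algebra through the exponential map, so that `p * q = p + q + [p, q] / 2`, the identity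
is `0` and the inverse of `p` is `-p`. -/
def mul (p q : PseudoEuclidean r s × V) : PseudoEuclidean r s × V :=
  p + q + ((1 / 2 : ℝ) • M.bracket p.2 q.2, 0)

theorem mul_assoc' (p q k : PseudoEuclidean r s × V) :
    M.mul (M.mul p q) k = M.mul p (M.mul q k) := by
  refine Prod.ext ?_ ?_
  · simp only [mul, Prod.fst_add, Prod.snd_add, map_add, LinearMap.add_apply, add_zero, smul_add]
    abel
  · simp [mul, add_assoc]

theorem mul_zero' (p : PseudoEuclidean r s × V) : M.mul p 0 = p := by
  simp [mul]

theorem zero_mul' (p : PseudoEuclidean r s × V) : M.mul 0 p = p := by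
  simp [mul]

theorem neg_mul_self' (p : PseudoEuclidean r s × V) : M.mul (-p) p = 0 := by
  simp [mul, bracket_self]

end Algebra

section Metric

variable {r s : ℕ} {V : Type*} [NormedAddCommGroup V] [NormedSpace ℝ V]
  (M : AdmissibleModule r s V)

/-- The left invariant metric of the pseudo `H`-type group: tangent vectors at `p` are carried to
the identity by the differential of the left translation by `p⁻¹ = -p`. -/
def metric (p u w : PseudoEuclidean r s × V) : ℝ :=
  M.scalarProduct (fderiv ℝ (M.mul (-p)) p u) (fderiv ℝ (M.mul (-p)) p w)

theorem fderiv_mul [FiniteDimensional ℝ V] (p q u : PseudoEuclidean r s × V) :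
    fderiv ℝ (M.mul p) q u = (u.1 + (1 / 2 : ℝ) • M.bracket p.2 u.2, u.2) := by
  let L : (PseudoEuclidean r s × V) →ₗ[ℝ] (PseudoEuclidean r s × V) :=
    LinearMap.id + (LinearMap.inl ℝ (PseudoEuclidean r s) V) ∘ₗ
      ((1 / 2 : ℝ) • (M.bracket p.2 ∘ₗ LinearMap.snd ℝ (PseudoEuclidean r s) V))
  have hL : M.mul p = fun x => p + L.toContinuousLinearMap x := by
    funext x; simp [mul, L, add_assoc]
  have h : HasFDerivAt (M.mul p) L.toContinuousLinearMap q := by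
    rw [hL]; exact (L.toContinuousLinearMap.hasFDerivAt).const_add p
  rw [h.fderiv]
  ext i <;> simp [L]

theorem metric_eq [FiniteDimensional ℝ V] (p u w : PseudoEuclidean r s × V) :
    M.metric p u w =
      pseudoInner r s (u.1 - (1 / 2 : ℝ) • M.bracket p.2 u.2) (w.1 - (1 / 2 : ℝ) • M.bracket p.2 w.2)
        + M.form u.2 w.2 := by
  simp [metric, scalarProduct, fderiv_mul, sub_eq_add_neg]

theorem metric_zero [FiniteDimensional ℝ V] (u w : PseudoEuclidean r s × V) :
    M.metric 0 u w = M.scalarProduct u w := by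
  simp [metric_eq, scalarProduct]

theorem metric_left_invariant [FiniteDimensional ℝ V] (p q u w : PseudoEuclidean r s × V) :
    M.metric (M.mul p q) (fderiv ℝ (M.mul p) q u) (fderiv ℝ (M.mul p) q w) = M.metric q u w := by
  have h : ∀ x : PseudoEuclidean r s × V, x.1 + (1 / 2 : ℝ) • M.bracket p.2 x.2
      - (1 / 2 : ℝ) • M.bracket (M.mul p q).2 x.2 = x.1 - (1 / 2 : ℝ) • M.bracket q.2 x.2 := by
    intro x
    simp only [mul, Prod.snd_add, add_zero, map_add, LinearMap.add_apply, smul_add]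
    abel
  simp only [metric_eq, fderiv_mul, h]

/-- The pseudo `H`-type group of `M`, with its left invariant metric, is geodesic orbit. -/
def IsGeodesicOrbit : Prop := IsGeodesicOrbitAt M.metric 0

end Metric

end AdmissibleModule

end

/-! No pseudo `H`-type group whose center contains eight orthonormal basis vectors with suitable
signs is geodesic orbit, and adding `(8,0)`, `(0,8)` or `(4,4)` always supplies such vectors.

Let `A_t` be the differential at the identity of an isometry `φ_t`, read in left trivializations.
Isometries preserve the connection and the curvature, hence the Ricci form (`trace_jacobi`). That
form has different factors on the center and on `V`, so `A_t` preserves both summands with their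
scalar products, as well as the bracket and the Clifford multiplication. Consequently the 3-form
`⟨J_a J_b J_c X, X⟩` is invariant when all four arguments are moved by `A_t` (`triple_trivDeriv`).

If the geodesic with initial vector `(Z, X)` is an orbit, then the velocity of `A_t X` at `t = 0` is
`k X + m J_Z X` with `m ≠ 0` (`exists_hasDerivAt_trivDeriv`). Differentiating the invariance gives
`2m⟨J_Z J_a J_b J_c X, X⟩ = 0`, provided that the 3-form of `X` vanishes whenever two of its
arguments lie in `{a, b, c}` and that `Z, a, b, c` are orthogonal.

It remains to find `X` with this property and a nonzero 4-form value (`exists_spinor`). Four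
commuting symmetric involutions, each a Clifford product of four of the eight vectors, have a common
non-isotropic eigenvector `X`. A triple product that anticommutes with one of them has zero value on
`X`, while the involution `J_Z J_a J_b J_c` itself has a nonzero value. This is the contradiction in
`not_isGeodesicOrbit_of_signs`. -/

theorem mul_mul_eq_smul_of_eq_smul {A : Type*} [Ring A] [Algebra ℝ A] {x y z : A} {c d : ℝ}
    (hy : x * y = c • (y * x)) (hz : x * z = d • (z * x)) :
    x * (y * z) = (c * d) • (y * z * x) := by
  rw [← mul_assoc, hy, smul_mul_assoc, mul_assoc, hz, mul_smul_comm, smul_smul, mul_assoc]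

theorem mul_mul_eq_smul_of_smul_eq {A : Type*} [Ring A] [Algebra ℝ A] {x y z : A} {c d : ℝ}
    (hy : y * x = c • (x * y)) (hz : z * x = d • (x * z)) :
    y * z * x = (c * d) • (x * (y * z)) := by
  rw [mul_assoc, hz, mul_smul_comm, ← mul_assoc, hy, smul_mul_assoc, smul_smul, mul_assoc,
    mul_comm d c]

/-! ### Clifford products of basis vectors and a distinguished spinor -/

namespace AdmissibleModule

section Spinor

variable {r s : ℕ} {V : Type*} [AddCommGroup V] [Module ℝ V] (M : AdmissibleModule r s V)

theorem form_J (Z : PseudoEuclidean r s) (X Y : V) :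
    M.form (M.J Z X) Y = -M.form X (M.J Z Y) := M.skew Z X Y

theorem form_J_self (Z : PseudoEuclidean r s) (X : V) : M.form (M.J Z X) X = 0 := by
  have h := M.form_J Z X X
  rw [M.form_symm.eq X (M.J Z X)] at h
  linarith

theorem J_J_add_swap (Z W : PseudoEuclidean r s) (X : V) :
    M.J Z (M.J W X) + M.J W (M.J Z X) =
      -(pseudoInner r s Z W + pseudoInner r s W Z) • X := by
  have h0 : M.J (Z + W) (M.J (Z + W) X) = (M.J Z + M.J W) ((M.J Z + M.J W) X) := by
    rw [map_add]
  have h' : pseudoInner r s (Z + W) (Z + W) = pseudoInner r s Z Z + pseudoInner r s Z W +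
      (pseudoInner r s W Z + pseudoInner r s W W) := by
    simp only [map_add, LinearMap.add_apply]
    ring
  rw [M.J_sq (Z + W) X, h'] at h0
  simp only [map_add, LinearMap.add_apply, M.J_sq Z, M.J_sq W] at h0
  linear_combination (norm := module) -h0

/-- The trilinear form `⟨J_a J_b J_c X, X⟩` on `ℝ^{r,s}`. -/
noncomputable def triple (X : V) (a b c : PseudoEuclidean r s) : ℝ :=
  M.form (M.J a (M.J b (M.J c X))) X

/-- The anticommutator of `J_a` and `J_b` is a scalar, and `⟨J_c X, X⟩ = 0` by skewness. With
`triple_swap_right` this makes the form alternating. -/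
theorem triple_swap_left (X : V) (a b c : PseudoEuclidean r s) :
    M.triple X a b c = -M.triple X b a c := by
  have h := congrArg (fun Y => M.form Y X) (M.J_J_add_swap a b (M.J c X))
  simp only [map_add, LinearMap.add_apply, map_smul, LinearMap.smul_apply, form_J_self,
    smul_zero] at h
  simp only [triple]
  linarith

theorem triple_swap_right (X : V) (a b c : PseudoEuclidean r s) :
    M.triple X a b c = -M.triple X a c b := by
  have h := congrArg (fun Y => M.form (M.J a Y) X) (M.J_J_add_swap b c X)
  simp only [map_add, LinearMap.add_apply, map_smul, LinearMap.smul_apply, form_J_self,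
    smul_zero] at h
  simp only [triple]
  linarith

/-- The Clifford multiplication by a vector of the standard basis. -/
noncomputable def gen (i : Fin r ⊕ Fin s) : Module.End ℝ V := M.J (Pi.single i 1)

/-- The square norm of a vector of the standard basis. -/
def basisSign (i : Fin r ⊕ Fin s) : ℝ := Sum.elim (fun _ => 1) (fun _ => -1) i

theorem basisSign_mul_self (i : Fin r ⊕ Fin s) : basisSign i * basisSign i = 1 := by
  cases i <;> simp [basisSign]

theorem pseudoInner_single (i j : Fin r ⊕ Fin s) :
    pseudoInner r s (Pi.single i 1) (Pi.single j 1) = if i = j then basisSign i else 0 := by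
  rcases i with i | i <;> rcases j with j | j <;>
    simp [pseudoInner, Pi.single_apply, basisSign, eq_comm, apply_ite]

theorem gen_mul_self (i : Fin r ⊕ Fin s) : M.gen i * M.gen i = -basisSign i • 1 := by
  ext X
  simp [gen, M.J_sq, pseudoInner_single]

theorem gen_mul_gen (i j : Fin r ⊕ Fin s) :
    M.gen i * M.gen j = (if i = j then (1 : ℝ) else -1) • (M.gen j * M.gen i) := by
  split_ifs with h
  · rw [h, one_smul]
  · ext X
    have := M.J_J_add_swap (Pi.single i 1) (Pi.single j 1) X
    rw [pseudoInner_single, pseudoInner_single, if_neg h, if_neg (Ne.symm h)] at this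
    simp only [add_zero, neg_zero, zero_smul] at this
    simpa [gen] using eq_neg_of_add_eq_zero_left this

/-- The Clifford product of four basis vectors. -/
noncomputable def quad (a b c d : Fin r ⊕ Fin s) : Module.End ℝ V :=
  M.gen a * (M.gen b * (M.gen c * M.gen d))

/-- Each factor different from `i` contributes `-1`, so the total sign is `-1` exactly when `i` is
one of four distinct indices. The `if` form lets `simp` evaluate the sign for concrete indices. -/
theorem gen_mul_quad (i a b c d : Fin r ⊕ Fin s) :
    M.gen i * M.quad a b c d =
      ((if i = a then (1 : ℝ) else -1) * ((if i = b then (1 : ℝ) else -1) *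
        ((if i = c then (1 : ℝ) else -1) * (if i = d then (1 : ℝ) else -1)))) •
        (M.quad a b c d * M.gen i) :=
  mul_mul_eq_smul_of_eq_smul (M.gen_mul_gen i a) <|
    mul_mul_eq_smul_of_eq_smul (M.gen_mul_gen i b) <|
      mul_mul_eq_smul_of_eq_smul (M.gen_mul_gen i c) (M.gen_mul_gen i d)

theorem form_gen (i : Fin r ⊕ Fin s) (X Y : V) :
    M.form (M.gen i X) Y = -M.form X (M.gen i Y) := M.form_J _ X Y

theorem gen_gen_of_ne {i j : Fin r ⊕ Fin s} (h : i ≠ j) (X : V) :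
    M.gen i (M.gen j X) = -M.gen j (M.gen i X) := by
  simpa [h] using LinearMap.congr_fun (M.gen_mul_gen i j) X

/-- Passing to the adjoint gives four signs and reverses the order; the reversal takes six
anticommutations, so every sign cancels. -/
theorem form_quad {a b c d : Fin r ⊕ Fin s} (hab : a ≠ b) (hac : a ≠ c) (had : a ≠ d)
    (hbc : b ≠ c) (hbd : b ≠ d) (hcd : c ≠ d) (X Y : V) :
    M.form (M.quad a b c d X) Y = M.form X (M.quad a b c d Y) := by
  simp only [quad, Module.End.mul_apply, form_gen, neg_neg]
  rw [M.gen_gen_of_ne hcd.symm, M.gen_gen_of_ne hbd.symm, M.gen_gen_of_ne had.symm]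
  simp only [map_neg, neg_neg]
  rw [M.gen_gen_of_ne hbc.symm, M.gen_gen_of_ne hac.symm]
  simp only [map_neg, neg_neg]
  rw [M.gen_gen_of_ne hab.symm]
  simp only [map_neg, neg_neg]

theorem gen_gen_self (i : Fin r ⊕ Fin s) (X : V) : M.gen i (M.gen i X) = -basisSign i • X := by
  simpa using LinearMap.congr_fun (M.gen_mul_self i) X

theorem quad_mul_self {a b c d : Fin r ⊕ Fin s} (hab : a ≠ b) (hac : a ≠ c) (had : a ≠ d)
    (hbc : b ≠ c) (hbd : b ≠ d) (hcd : c ≠ d)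
    (h : basisSign a * basisSign b * basisSign c * basisSign d = 1) :
    M.quad a b c d * M.quad a b c d = 1 := by
  ext X
  simp only [quad, Module.End.mul_apply, Module.End.one_apply]
  rw [M.gen_gen_of_ne had.symm]
  simp only [map_neg]
  rw [M.gen_gen_of_ne hac.symm]
  simp only [map_neg]
  rw [M.gen_gen_of_ne hab.symm, M.gen_gen_of_ne hbd.symm]
  simp only [map_neg]
  rw [M.gen_gen_of_ne hbc.symm, M.gen_gen_of_ne hcd.symm]
  simp only [map_neg, gen_gen_self, map_smul, neg_neg, smul_neg, neg_smul, smul_smul]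
  rw [show basisSign d * basisSign c * basisSign b * basisSign a = 1 by linarith, one_smul]

theorem quad_mul_quad (i j k l a b c d : Fin r ⊕ Fin s) :
    M.quad i j k l * M.quad a b c d =
      (((if i = a then (1 : ℝ) else -1) * ((if i = b then (1 : ℝ) else -1) *
        ((if i = c then (1 : ℝ) else -1) * (if i = d then (1 : ℝ) else -1)))) *
      (((if j = a then (1 : ℝ) else -1) * ((if j = b then (1 : ℝ) else -1) *
        ((if j = c then (1 : ℝ) else -1) * (if j = d then (1 : ℝ) else -1)))) *
      (((if k = a then (1 : ℝ) else -1) * ((if k = b then (1 : ℝ) else -1) *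
        ((if k = c then (1 : ℝ) else -1) * (if k = d then (1 : ℝ) else -1)))) *
      ((if l = a then (1 : ℝ) else -1) * ((if l = b then (1 : ℝ) else -1) *
        ((if l = c then (1 : ℝ) else -1) * (if l = d then (1 : ℝ) else -1))))))) •
        (M.quad a b c d * M.quad i j k l) :=
  mul_mul_eq_smul_of_smul_eq (M.gen_mul_quad i a b c d) <|
    mul_mul_eq_smul_of_smul_eq (M.gen_mul_quad j a b c d) <|
      mul_mul_eq_smul_of_smul_eq (M.gen_mul_quad k a b c d) (M.gen_mul_quad l a b c d)

theorem gen_mul_gen_mul_gen_mul_quad (i j k a b c d : Fin r ⊕ Fin s) :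
    M.gen i * (M.gen j * M.gen k) * M.quad a b c d =
      (((if i = a then (1 : ℝ) else -1) * ((if i = b then (1 : ℝ) else -1) *
        ((if i = c then (1 : ℝ) else -1) * (if i = d then (1 : ℝ) else -1)))) *
      (((if j = a then (1 : ℝ) else -1) * ((if j = b then (1 : ℝ) else -1) *
        ((if j = c then (1 : ℝ) else -1) * (if j = d then (1 : ℝ) else -1)))) *
      ((if k = a then (1 : ℝ) else -1) * ((if k = b then (1 : ℝ) else -1) *
        ((if k = c then (1 : ℝ) else -1) * (if k = d then (1 : ℝ) else -1)))))) •
        (M.quad a b c d * (M.gen i * (M.gen j * M.gen k))) :=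
  mul_mul_eq_smul_of_smul_eq (M.gen_mul_quad i a b c d) <|
    mul_mul_eq_smul_of_smul_eq (M.gen_mul_quad j a b c d) (M.gen_mul_quad k a b c d)

/-- A spinor is isotropic for an operator that anticommutes with a symmetric operator having
the spinor as an eigenvector. -/
theorem form_eq_zero_of_anticomm {P Q : Module.End ℝ V} {X : V} {c : ℝ} (hc : c ≠ 0)
    (hP : ∀ Y Y', M.form (P Y) Y' = M.form Y (P Y')) (hX : P X = c • X)
    (h : Q * P = (-1 : ℝ) • (P * Q)) : M.form (Q X) X = 0 := by
  have h1 := congrArg (fun Y => M.form Y X) (LinearMap.congr_fun h X)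
  simp only [Module.End.mul_apply, hX, map_smul, LinearMap.smul_apply, hP, smul_eq_mul] at h1
  have h2 : c * M.form (Q X) X = 0 := by linarith
  exact (mul_eq_zero.1 h2).resolve_left hc

/-- A non-isotropic vector has a non-isotropic projection to an eigenspace of a symmetric
involution. -/
theorem exists_eigenvector {P : Module.End ℝ V} (hP : ∀ Y Y', M.form (P Y) Y' = M.form Y (P Y'))
    (hPP : P * P = 1) {X : V} (hX : M.form X X ≠ 0) :
    ∃ c : ℝ, c ≠ 0 ∧ M.form (X + c • P X) (X + c • P X) ≠ 0 ∧
      P (X + c • P X) = c • (X + c • P X) := by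
  have hPP' : ∀ Y, P (P Y) = Y := fun Y => LinearMap.congr_fun hPP Y
  have hn : ∀ c : ℝ, c * c = 1 → M.form (X + c • P X) (X + c • P X) =
      2 * M.form X X + 2 * c * M.form X (P X) := by
    intro c hc
    simp only [map_add, LinearMap.add_apply, map_smul, LinearMap.smul_apply, smul_eq_mul, hP, hPP']
    linear_combination M.form X X * hc
  have he : ∀ c : ℝ, c * c = 1 → P (X + c • P X) = c • (X + c • P X) := by
    intro c hc
    simp only [map_add, map_smul, hPP', smul_add, smul_smul, hc, one_smul, add_comm]
  -- The square norms for `c = 1` and `c = -1` add up to `4⟨X, X⟩`, so they cannot both vanish.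
  by_cases h : M.form (X + (1 : ℝ) • P X) (X + (1 : ℝ) • P X) = 0
  · refine ⟨-1, by norm_num, ?_, he _ (by norm_num)⟩
    rw [hn _ (by norm_num)] at h ⊢
    intro h'
    exact hX (by linarith)
  · exact ⟨1, one_ne_zero, h, he _ (by norm_num)⟩

/-- Keeps the eigenvector relations already obtained when the vector is projected to an eigenspace
of a further commuting involution. -/
theorem apply_eigenvector {P Q : Module.End ℝ V} {X : V} {c d : ℝ} (h : Q * P = P * Q)
    (hX : Q X = d • X) : Q (X + c • P X) = d • (X + c • P X) := by
  have : Q (P X) = P (Q X) := LinearMap.congr_fun h X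
  rw [map_add, map_smul, this, hX, map_smul, smul_add, smul_comm]

theorem exists_form_self_ne_zero [Nontrivial V] : ∃ X : V, M.form X X ≠ 0 := by
  by_contra! h
  obtain ⟨X, hX⟩ := exists_ne (0 : V)
  refine hX (M.form_nondegenerate.1 X fun Y => ?_)
  have h1 := h (X + Y)
  simp only [map_add, LinearMap.add_apply, h, M.form_symm.eq Y X] at h1
  linarith

/-- For eight distinct basis vectors with suitable signs there is a spinor for which the 3-form
`triple` has most of them in its radical, while a 4-form does not vanish. -/
theorem exists_spinor [Nontrivial V] (f : Fin 8 → Fin r ⊕ Fin s) (hf : Function.Injective f)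
    (h1 : basisSign (f 0) * basisSign (f 1) * basisSign (f 2) * basisSign (f 3) = 1)
    (h2 : basisSign (f 0) * basisSign (f 1) * basisSign (f 4) * basisSign (f 5) = 1)
    (h3 : basisSign (f 0) * basisSign (f 1) * basisSign (f 6) * basisSign (f 7) = 1)
    (h4 : basisSign (f 0) * basisSign (f 2) * basisSign (f 4) * basisSign (f 6) = 1) :
    ∃ X : V, M.form (M.quad (f 0) (f 1) (f 2) (f 3) X) X ≠ 0 ∧
      ∀ b ∈ ({1, 2, 3} : Finset (Fin 8)), ∀ c ∈ ({1, 2, 3} : Finset (Fin 8)), b ≠ c →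
        ∀ w, M.triple X w (Pi.single (f b) 1) (Pi.single (f c) 1) = 0 := by
  have hne : ∀ i j : Fin 8, i ≠ j → f i ≠ f j := fun i j h => hf.ne h
  have hsym : ∀ a b c d : Fin 8, a ≠ b → a ≠ c → a ≠ d → b ≠ c → b ≠ d → c ≠ d → ∀ Y Y',
      M.form (M.quad (f a) (f b) (f c) (f d) Y) Y' = M.form Y (M.quad (f a) (f b) (f c) (f d) Y') :=
    fun a b c d hab hac had hbc hbd hcd => M.form_quad (hne _ _ hab) (hne _ _ hac) (hne _ _ had)
      (hne _ _ hbc) (hne _ _ hbd) (hne _ _ hcd)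
  have hinv : ∀ a b c d : Fin 8, a ≠ b → a ≠ c → a ≠ d → b ≠ c → b ≠ d → c ≠ d →
      basisSign (f a) * basisSign (f b) * basisSign (f c) * basisSign (f d) = 1 →
      M.quad (f a) (f b) (f c) (f d) * M.quad (f a) (f b) (f c) (f d) = 1 :=
    fun a b c d hab hac had hbc hbd hcd => M.quad_mul_self (hne _ _ hab) (hne _ _ hac)
      (hne _ _ had) (hne _ _ hbc) (hne _ _ hbd) (hne _ _ hcd)
  have s1 := hsym 0 1 2 3 (by decide) (by decide) (by decide) (by decide) (by decide) (by decide)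
  have s2 := hsym 0 1 4 5 (by decide) (by decide) (by decide) (by decide) (by decide) (by decide)
  have s3 := hsym 0 1 6 7 (by decide) (by decide) (by decide) (by decide) (by decide) (by decide)
  have s4 := hsym 0 2 4 6 (by decide) (by decide) (by decide) (by decide) (by decide) (by decide)
  have i1 := hinv 0 1 2 3 (by decide) (by decide) (by decide) (by decide) (by decide) (by decide) h1
  have i2 := hinv 0 1 4 5 (by decide) (by decide) (by decide) (by decide) (by decide) (by decide) h2
  have i3 := hinv 0 1 6 7 (by decide) (by decide) (by decide) (by decide) (by decide) (by decide) h3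
  have i4 := hinv 0 2 4 6 (by decide) (by decide) (by decide) (by decide) (by decide) (by decide) h4
  -- The index sets 0123, 0145, 0167, 0246 meet pairwise in two elements, so the four involutions
  -- commute.
  have c12 := M.quad_mul_quad (f 0) (f 1) (f 2) (f 3) (f 0) (f 1) (f 4) (f 5)
  have c13 := M.quad_mul_quad (f 0) (f 1) (f 2) (f 3) (f 0) (f 1) (f 6) (f 7)
  have c14 := M.quad_mul_quad (f 0) (f 1) (f 2) (f 3) (f 0) (f 2) (f 4) (f 6)
  have c23 := M.quad_mul_quad (f 0) (f 1) (f 4) (f 5) (f 0) (f 1) (f 6) (f 7)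
  have c24 := M.quad_mul_quad (f 0) (f 1) (f 4) (f 5) (f 0) (f 2) (f 4) (f 6)
  have c34 := M.quad_mul_quad (f 0) (f 1) (f 6) (f 7) (f 0) (f 2) (f 4) (f 6)
  simp only [hf.eq_iff] at c12 c13 c14 c23 c24 c34
  norm_num [Fin.ext_iff] at c12 c13 c14 c23 c24 c34
  obtain ⟨X₀, hX₀⟩ := M.exists_form_self_ne_zero
  obtain ⟨d₁, hd₁, n₁, e₁⟩ := M.exists_eigenvector s1 i1 hX₀
  obtain ⟨d₂, hd₂, n₂, e₂⟩ := M.exists_eigenvector s2 i2 n₁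
  replace e₁ := apply_eigenvector (c := d₂) c12 e₁
  obtain ⟨d₃, hd₃, n₃, e₃⟩ := M.exists_eigenvector s3 i3 n₂
  replace e₁ := apply_eigenvector (c := d₃) c13 e₁
  replace e₂ := apply_eigenvector (c := d₃) c23 e₂
  obtain ⟨d₄, hd₄, n₄, e₄⟩ := M.exists_eigenvector s4 i4 n₃
  replace e₁ := apply_eigenvector (c := d₄) c14 e₁
  replace e₂ := apply_eigenvector (c := d₄) c24 e₂
  replace e₃ := apply_eigenvector (c := d₄) c34 e₃
  clear i1 i2 i3 i4 c12 c13 c14 c23 c24 c34 hinv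
  revert n₄ e₁ e₂ e₃ e₄
  generalize (_ : V) + d₄ • _ = X
  intro n₄ e₄ e₁ e₂ e₃
  refine ⟨X, ?_, ?_⟩
  · rw [e₁, map_smul, LinearMap.smul_apply, smul_eq_mul]
    exact mul_ne_zero hd₁ n₄
  -- The sign is `-1` to the number of indices among `i, b, c` that lie in `{j, k, l, m}` (when the
  -- latter are distinct), so an involution containing an odd number of them kills the triple.
  have key : ∀ {i b c : Fin r ⊕ Fin s} {j k l m : Fin r ⊕ Fin s} {d : ℝ}, d ≠ 0 →
      (∀ Y Y', M.form (M.quad j k l m Y) Y' = M.form Y (M.quad j k l m Y')) →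
      M.quad j k l m X = d • X →
      (((if i = j then (1 : ℝ) else -1) * ((if i = k then (1 : ℝ) else -1) *
        ((if i = l then (1 : ℝ) else -1) * (if i = m then (1 : ℝ) else -1)))) *
      (((if b = j then (1 : ℝ) else -1) * ((if b = k then (1 : ℝ) else -1) *
        ((if b = l then (1 : ℝ) else -1) * (if b = m then (1 : ℝ) else -1)))) *
      ((if c = j then (1 : ℝ) else -1) * ((if c = k then (1 : ℝ) else -1) *
        ((if c = l then (1 : ℝ) else -1) * (if c = m then (1 : ℝ) else -1)))))) = -1 →
      M.triple X (Pi.single i 1) (Pi.single b 1) (Pi.single c 1) = 0 := by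
    intro i b c j k l m d hd hs he hsgn
    refine M.form_eq_zero_of_anticomm (Q := M.gen i * (M.gen b * M.gen c)) hd hs he ?_
    rw [gen_mul_gen_mul_gen_mul_quad, hsgn]
  have hbasis : ∀ b ∈ ({1, 2, 3} : Finset (Fin 8)), ∀ c ∈ ({1, 2, 3} : Finset (Fin 8)), b ≠ c →
      ∀ i, M.triple X (Pi.single i 1) (Pi.single (f b) 1) (Pi.single (f c) 1) = 0 := by
    intro b hb c hc hbc i
    by_cases hib : i = f b
    · rw [hib, triple, M.J_sq, LinearMap.map_smul₂, form_J_self, smul_zero]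
    by_cases hic : i = f c
    · rw [hic, triple_swap_right, triple, M.J_sq, LinearMap.map_smul₂, form_J_self, smul_zero,
        neg_zero]
    -- Inside the eight vectors the first three involutions suffice: 0123 contains all three indices
    -- when `k ≤ 3`; otherwise 0145 or 0167 meets the triple in an odd number.
    by_cases hi : ∃ k, f k = i
    · obtain ⟨k, rfl⟩ := hi
      rw [hf.eq_iff] at hib hic
      fin_cases hb <;> fin_cases hc <;> fin_cases k <;>
        first
        | exact absurd rfl hbc
        | exact absurd rfl hib
        | exact absurd rfl hic
        | (refine key hd₁ s1 e₁ ?_; simp only [hf.eq_iff]; norm_num [Fin.ext_iff]; done)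
        | (refine key hd₂ s2 e₂ ?_; simp only [hf.eq_iff]; norm_num [Fin.ext_iff]; done)
        | (refine key hd₃ s3 e₃ ?_; simp only [hf.eq_iff]; norm_num [Fin.ext_iff])
    -- For `i` outside the eight, 0145 contains only the index 1 of `{1,2}` or `{1,3}`. The pair
    -- `{2,3}` is what requires 0246.
    · have hi' : ∀ k, i ≠ f k := fun k h => hi ⟨k, h.symm⟩
      fin_cases hb <;> fin_cases hc <;>
        first
        | exact absurd rfl hbc
        | (refine key hd₂ s2 e₂ ?_; simp only [hf.eq_iff, hi']; norm_num [Fin.ext_iff]; done)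
        | (refine key hd₄ s4 e₄ ?_; simp only [hf.eq_iff, hi']; norm_num [Fin.ext_iff])
  intro b hb c hc hbc w
  have hw : w = ∑ i, w i • (Pi.single i (1 : ℝ) : PseudoEuclidean r s) := by
    ext j; simp [Finset.sum_apply, Pi.single_apply]
  have h := hbasis b hb c hc hbc
  unfold triple at h ⊢
  rw [hw]
  simp only [map_sum, map_smul, LinearMap.sum_apply, LinearMap.smul_apply, h, smul_zero,
    Finset.sum_const_zero]

end Spinor
end AdmissibleModule

/-! ### Levi-Civita connection, curvature and Ricci form on the Lie algebra -/

namespace AdmissibleModule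

section LeviCivita

variable {r s : ℕ} {V : Type*} [AddCommGroup V] [Module ℝ V] (M : AdmissibleModule r s V)

/-- The Lie bracket of the pseudo `H`-type Lie algebra. -/
noncomputable def lie (x y : PseudoEuclidean r s × V) : PseudoEuclidean r s × V :=
  (M.bracket x.2 y.2, 0)

/-- The scalar product of the pseudo `H`-type Lie algebra as a bilinear form. -/
noncomputable def ip : LinearMap.BilinForm ℝ (PseudoEuclidean r s × V) :=
  (pseudoInner r s).compl₁₂ (LinearMap.fst ℝ _ _) (LinearMap.fst ℝ _ _) +
    M.form.compl₁₂ (LinearMap.snd ℝ _ _) (LinearMap.snd ℝ _ _)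

@[simp]
theorem ip_apply (x y : PseudoEuclidean r s × V) :
    M.ip x y = pseudoInner r s x.1 y.1 + M.form x.2 y.2 := rfl

theorem pseudoInner_comm (Z W : PseudoEuclidean r s) :
    pseudoInner r s Z W = pseudoInner r s W Z := by
  simp [pseudoInner, mul_comm]

theorem eq_zero_of_pseudoInner {Z : PseudoEuclidean r s} (h : ∀ W, pseudoInner r s Z W = 0) :
    Z = 0 := by
  ext i
  have := h (Pi.single i 1)
  rcases i with i | i <;> simpa [pseudoInner, Pi.single_apply] using this

theorem ip_comm (x y : PseudoEuclidean r s × V) : M.ip x y = M.ip y x := by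
  rw [ip_apply, ip_apply, pseudoInner_comm, M.form_symm.eq]

theorem eq_zero_of_ip {x : PseudoEuclidean r s × V} (h : ∀ y, M.ip x y = 0) : x = 0 := by
  refine Prod.ext (eq_zero_of_pseudoInner fun W => ?_) (M.form_nondegenerate.1 _ fun Y => ?_)
  · simpa using h (W, 0)
  · simpa using h (0, Y)

/-- The Levi-Civita connection on left invariant vector fields. -/
noncomputable def nabla : (PseudoEuclidean r s × V) →ₗ[ℝ]
    (PseudoEuclidean r s × V) →ₗ[ℝ] (PseudoEuclidean r s × V) :=
  LinearMap.mk₂ ℝ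
    (fun x y => ((1 / 2 : ℝ) • M.bracket x.2 y.2, -(1 / 2 : ℝ) • (M.J x.1 y.2 + M.J y.1 x.2)))
    (fun x x' y => by
      refine Prod.ext ?_ ?_
      · simp
      · simp; module)
    (fun c x y => by refine Prod.ext ?_ ?_ <;> simp <;> module)
    (fun x y y' => by
      refine Prod.ext ?_ ?_
      · simp
      · simp; module)
    (fun c x y => by refine Prod.ext ?_ ?_ <;> simp <;> module)

theorem nabla_apply (x y : PseudoEuclidean r s × V) : M.nabla x y =
    ((1 / 2 : ℝ) • M.bracket x.2 y.2, -(1 / 2 : ℝ) • (M.J x.1 y.2 + M.J y.1 x.2)) := rfl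

theorem bracket_swap (X Y : V) : M.bracket X Y = -M.bracket Y X := by
  have h := M.bracket_self (X + Y)
  simp only [map_add, LinearMap.add_apply, bracket_self, zero_add, add_zero] at h
  exact eq_neg_of_add_eq_zero_right h

theorem lie_swap (x y : PseudoEuclidean r s × V) : M.lie x y = -M.lie y x := by
  simp only [lie, M.bracket_swap x.2, Prod.neg_mk, neg_zero]

/-- Vanishing torsion. Together with `ip_nabla` it determines the connection, which is how
`along_trivDeriv_eq` uses it. -/
theorem nabla_sub_nabla (x y : PseudoEuclidean r s × V) :
    M.nabla x y - M.nabla y x = M.lie x y := by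
  refine Prod.ext ?_ ?_
  · simp only [nabla_apply, lie, Prod.fst_sub]
    rw [M.bracket_swap y.2]
    module
  · simp only [nabla_apply, lie, Prod.snd_sub]
    module

theorem ip_nabla_self (x y : PseudoEuclidean r s × V) : M.ip (M.nabla x y) y = 0 := by
  simp only [nabla_apply, ip_apply, map_smul, LinearMap.smul_apply, map_add, LinearMap.add_apply,
    pseudoInner_bracket, smul_eq_mul, form_J_self]
  ring

theorem ip_nabla (x y z : PseudoEuclidean r s × V) :
    M.ip (M.nabla x y) z = -M.ip y (M.nabla x z) := by
  have h := M.ip_nabla_self x (y + z)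
  rw [map_add] at h
  simp only [map_add, LinearMap.add_apply, M.ip_nabla_self] at h
  rw [M.ip_comm y]
  linarith

/-- The curvature tensor of the left invariant metric. -/
noncomputable def curvature (x y z : PseudoEuclidean r s × V) : PseudoEuclidean r s × V :=
  M.nabla x (M.nabla y z) - M.nabla y (M.nabla x z) - M.nabla (M.lie x y) z

/-- The Jacobi operator `y ↦ R(y, x) x`. -/
noncomputable def jacobi (x : PseudoEuclidean r s × V) :
    Module.End ℝ (PseudoEuclidean r s × V) where
  toFun y := M.curvature y x x
  map_add' y y' := by
    simp only [curvature, lie, Prod.snd_add, map_add, LinearMap.add_apply]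
    rw [show (M.bracket y.2 x.2 + M.bracket y'.2 x.2, (0 : V)) =
      (M.bracket y.2 x.2, 0) + (M.bracket y'.2 x.2, 0) by simp]
    simp only [map_add, LinearMap.add_apply]
    abel
  map_smul' c y := by
    simp only [curvature, lie, Prod.smul_snd, map_smul, LinearMap.smul_apply, RingHom.id_apply]
    rw [show (c • M.bracket y.2 x.2, (0 : V)) = c • (M.bracket y.2 x.2, 0) by simp]
    simp only [map_smul, LinearMap.smul_apply]
    module

theorem trace_prod {A B : Type*} [AddCommGroup A] [Module ℝ A] [AddCommGroup B] [Module ℝ B]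
    [FiniteDimensional ℝ A] [FiniteDimensional ℝ B] (F : Module.End ℝ (A × B)) :
    LinearMap.trace ℝ _ F =
      LinearMap.trace ℝ _ (LinearMap.fst ℝ A B ∘ₗ F ∘ₗ LinearMap.inl ℝ A B) +
        LinearMap.trace ℝ _ (LinearMap.snd ℝ A B ∘ₗ F ∘ₗ LinearMap.inr ℝ A B) := by
  have h : F = (F ∘ₗ LinearMap.inl ℝ A B) ∘ₗ LinearMap.fst ℝ A B +
      (F ∘ₗ LinearMap.inr ℝ A B) ∘ₗ LinearMap.snd ℝ A B := by
    refine LinearMap.ext fun x => ?_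
    simp [← map_add]
  conv_lhs => rw [h]
  rw [map_add, LinearMap.trace_comp_comm', LinearMap.trace_comp_comm' (LinearMap.snd ℝ A B)]

/-- The operator `W ↦ [X, J_W X]` on the center. -/
noncomputable def bracketJ (X : V) : Module.End ℝ (PseudoEuclidean r s) :=
  M.bracket X ∘ₗ M.J.flip X

/-- Every diagonal entry is `⟨X, X⟩`: the sign `ε_i` in the coordinates of the bracket cancels the
one in `⟨J_i X, J_i X⟩ = ε_i⟨X, X⟩`. -/
theorem trace_bracketJ (X : V) :
    LinearMap.trace ℝ _ (M.bracketJ X) = (r + s : ℝ) * M.form X X := by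
  rw [LinearMap.trace_eq_matrix_trace ℝ (Pi.basisFun ℝ _), Matrix.trace]
  have h : ∀ i, (LinearMap.toMatrix (Pi.basisFun ℝ _) (Pi.basisFun ℝ _) (M.bracketJ X)).diag i =
      M.form X X := by
    intro i
    rw [Matrix.diag_apply, LinearMap.toMatrix_apply]
    have h2 : M.form (M.gen i X) (M.gen i X) = basisSign i * M.form X X := by
      rw [form_gen, gen_gen_self]
      simp
    change basisSign i * M.form (M.gen i X) (M.J (Pi.basisFun ℝ _ i) X) = _
    rw [Pi.basisFun_apply]
    change basisSign i * M.form (M.gen i X) (M.gen i X) = _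
    rw [h2, ← mul_assoc, basisSign_mul_self, one_mul]
  rw [Finset.sum_congr rfl fun i _ => h i]
  simp

/-- This is the Ricci quadratic form. Its coefficients on the two summands differ, which lets it
separate the center from `V`. -/
theorem trace_jacobi [FiniteDimensional ℝ V] (x : PseudoEuclidean r s × V) :
    LinearMap.trace ℝ _ (M.jacobi x) = (Module.finrank ℝ V / 4 : ℝ) * pseudoInner r s x.1 x.1 -
      ((r + s) / 2 : ℝ) * M.form x.2 x.2 := by
  have h1 : LinearMap.fst ℝ _ _ ∘ₗ M.jacobi x ∘ₗ LinearMap.inl ℝ _ _ =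
      (1 / 4 : ℝ) • M.bracketJ x.2 := by
    refine LinearMap.ext fun W => ?_
    simp [jacobi, curvature, lie, nabla_apply, bracketJ]
    module
  have h2 : LinearMap.snd ℝ _ _ ∘ₗ M.jacobi x ∘ₗ LinearMap.inr ℝ _ _ =
      (1 / 4 * pseudoInner r s x.1 x.1 : ℝ) • LinearMap.id -
        (3 / 4 : ℝ) • (M.J.flip x.2 ∘ₗ M.bracket x.2) := by
    refine LinearMap.ext fun Y => ?_
    simp [jacobi, curvature, lie, nabla_apply, J_sq]
    rw [bracket_self, M.bracket_swap Y]
    simp only [map_zero, map_neg, LinearMap.zero_apply, LinearMap.neg_apply]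
    module
  have h3 : LinearMap.trace ℝ _ (M.J.flip x.2 ∘ₗ M.bracket x.2) =
      LinearMap.trace ℝ _ (M.bracketJ x.2) := by
    rw [bracketJ, LinearMap.trace_comp_comm']
  rw [trace_prod, h1, h2, map_sub, map_smul, map_smul, map_smul, h3, trace_bracketJ,
    LinearMap.trace_id]
  simp only [smul_eq_mul]
  ring

end LeviCivita
end AdmissibleModule

/-! ### Differentiation along left invariant vector fields -/

namespace AdmissibleModule

section Frame

variable {r s : ℕ} {V : Type*} [NormedAddCommGroup V] [NormedSpace ℝ V] [FiniteDimensional ℝ V]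
  (M : AdmissibleModule r s V)
  {G : Type*} [NormedAddCommGroup G] [NormedSpace ℝ G]

/-- A bilinear map of finite dimensional spaces is differentiable. -/
theorem _root_.HasFDerivAt.linearMap_bilin {E A B C : Type*} [NormedAddCommGroup E]
    [NormedSpace ℝ E] [NormedAddCommGroup A] [NormedSpace ℝ A] [FiniteDimensional ℝ A]
    [NormedAddCommGroup B] [NormedSpace ℝ B] [FiniteDimensional ℝ B]
    [NormedAddCommGroup C] [NormedSpace ℝ C] (β : A →ₗ[ℝ] B →ₗ[ℝ] C)
    {f : E → A} {g : E → B} {f' : E →L[ℝ] A} {g' : E →L[ℝ] B} {p : E}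
    (hf : HasFDerivAt f f' p) (hg : HasFDerivAt g g' p) :
    HasFDerivAt (fun q => β (f q) (g q))
      (β.toContinuousBilinearMap.precompR E (f p) g' +
        β.toContinuousBilinearMap.precompL E f' (g p)) p := by
  exact β.toContinuousBilinearMap.hasFDerivAt_of_bilinear hf hg

theorem fderiv_bilin {E A B C : Type*} [NormedAddCommGroup E]
    [NormedSpace ℝ E] [NormedAddCommGroup A] [NormedSpace ℝ A] [FiniteDimensional ℝ A]
    [NormedAddCommGroup B] [NormedSpace ℝ B] [FiniteDimensional ℝ B]
    [NormedAddCommGroup C] [NormedSpace ℝ C] (β : A →ₗ[ℝ] B →ₗ[ℝ] C)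
    {f : E → A} {g : E → B} {p : E}
    (hf : DifferentiableAt ℝ f p) (hg : DifferentiableAt ℝ g p) (v : E) :
    fderiv ℝ (fun q => β (f q) (g q)) p v =
      β (f p) (fderiv ℝ g p v) + β (fderiv ℝ f p v) (g p) := by
  rw [(hf.hasFDerivAt.linearMap_bilin β hg.hasFDerivAt).fderiv]
  simp

theorem contDiff_bilin {E A B C : Type*} [NormedAddCommGroup E]
    [NormedSpace ℝ E] [NormedAddCommGroup A] [NormedSpace ℝ A] [FiniteDimensional ℝ A]
    [NormedAddCommGroup B] [NormedSpace ℝ B] [FiniteDimensional ℝ B]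
    [NormedAddCommGroup C] [NormedSpace ℝ C] (β : A →ₗ[ℝ] B →ₗ[ℝ] C)
    {f : E → A} {g : E → B} (hf : ContDiff ℝ ∞ f) (hg : ContDiff ℝ ∞ g) :
    ContDiff ℝ ∞ (fun q => β (f q) (g q)) :=
  (β.toContinuousBilinearMap.contDiff.comp hf).clm_apply hg

/-- The left invariant vector field with the value `x` at the identity. -/
noncomputable def frame (x p : PseudoEuclidean r s × V) : PseudoEuclidean r s × V :=
  (x.1 + (1 / 2 : ℝ) • M.bracket p.2 x.2, x.2)

theorem contDiff_frame (x : PseudoEuclidean r s × V) : ContDiff ℝ ∞ (M.frame x) := by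
  unfold frame
  exact (contDiff_const.add ((contDiff_bilin M.bracket contDiff_snd contDiff_const).const_smul
    (1 / 2 : ℝ))).prodMk contDiff_const

theorem fderiv_frame (x p v : PseudoEuclidean r s × V) :
    fderiv ℝ (M.frame x) p v = (1 / 2 : ℝ) • M.lie v x := by
  have h : HasFDerivAt (M.frame x) (((1 / 2 : ℝ) • (LinearMap.inl ℝ _ _ ∘ₗ M.bracket.flip x.2 ∘ₗ
      LinearMap.snd ℝ _ _)).toContinuousLinearMap) p := by
    have : M.frame x = fun q => x + ((1 / 2 : ℝ) • (LinearMap.inl ℝ _ _ ∘ₗ M.bracket.flip x.2 ∘ₗ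
      LinearMap.snd ℝ _ _)).toContinuousLinearMap q := by
      funext q
      simp [frame, Prod.ext_iff]
    rw [this]
    exact (ContinuousLinearMap.hasFDerivAt _).const_add x
  rw [h.fderiv]
  simp [lie]

/-- The derivative of a function along a left invariant vector field. -/
noncomputable def along (x : PseudoEuclidean r s × V) (f : PseudoEuclidean r s × V → G)
    (p : PseudoEuclidean r s × V) : G :=
  fderiv ℝ f p (M.frame x p)

theorem contDiff_along (x : PseudoEuclidean r s × V) {f : PseudoEuclidean r s × V → G}
    (hf : ContDiff ℝ ∞ f) : ContDiff ℝ ∞ (M.along x f) :=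
  (hf.fderiv_right (m := ∞) (by simp)).clm_apply (M.contDiff_frame x)

theorem along_along (x y : PseudoEuclidean r s × V) {f : PseudoEuclidean r s × V → G}
    (hf : ContDiff ℝ ∞ f) (p : PseudoEuclidean r s × V) :
    M.along x (M.along y f) p = fderiv ℝ (fderiv ℝ f) p (M.frame x p) (M.frame y p) +
      (1 / 2 : ℝ) • fderiv ℝ f p (M.lie x y) := by
  have h1 : DifferentiableAt ℝ (fderiv ℝ f) p :=
    (hf.fderiv_right (m := ∞) (by simp)).differentiable (by simp) p
  have h2 : DifferentiableAt ℝ (M.frame y) p :=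
    (M.contDiff_frame y).differentiable (by simp) p
  change fderiv ℝ (fun q => fderiv ℝ f q (M.frame y q)) p (M.frame x p) = _
  rw [(h1.hasFDerivAt.clm_apply h2.hasFDerivAt).fderiv]
  simp only [add_apply, ContinuousLinearMap.comp_apply,
    ContinuousLinearMap.flip_apply, fderiv_frame, map_smul]
  rw [add_comm]
  congr 3

/-- Symmetry of the second derivative leaves only the derivatives of the frame, which combine to the
bracket. A central vector has a constant left invariant field. -/
theorem along_along_sub (x y : PseudoEuclidean r s × V) {f : PseudoEuclidean r s × V → G}
    (hf : ContDiff ℝ ∞ f) (p : PseudoEuclidean r s × V) :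
    M.along x (M.along y f) p - M.along y (M.along x f) p = M.along (M.lie x y) f p := by
  have h := (hf.contDiffAt (x := p)).isSymmSndFDerivAt
    (by
      rw [minSmoothness_of_isRCLikeNormedField]
      exact WithTop.coe_le_coe.2 le_top) (M.frame x p) (M.frame y p)
  have h2 : M.frame (M.lie x y) p = M.lie x y := by simp [frame, lie]
  rw [M.along_along x y hf, M.along_along y x hf, h, M.lie_swap y x, along, h2, map_neg]
  module

end Frame
end AdmissibleModule

/-! ### Differentials of maps in the left trivialization -/

namespace AdmissibleModule

section Isometry

variable {r s : ℕ} {V : Type*} [NormedAddCommGroup V] [NormedSpace ℝ V]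
  (M : AdmissibleModule r s V)
  {G : Type*} [NormedAddCommGroup G] [NormedSpace ℝ G]

theorem along_bilin {A B C : Type*} [NormedAddCommGroup A] [NormedSpace ℝ A]
    [FiniteDimensional ℝ A] [NormedAddCommGroup B] [NormedSpace ℝ B] [FiniteDimensional ℝ B]
    [NormedAddCommGroup C] [NormedSpace ℝ C] (β : A →ₗ[ℝ] B →ₗ[ℝ] C)
    {f : PseudoEuclidean r s × V → A} {g : PseudoEuclidean r s × V → B}
    (hf : ContDiff ℝ ∞ f) (hg : ContDiff ℝ ∞ g) (x p : PseudoEuclidean r s × V) :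
    M.along x (fun q => β (f q) (g q)) p = β (f p) (M.along x g p) + β (M.along x f p) (g p) :=
  fderiv_bilin β (hf.differentiable (by simp) p) (hg.differentiable (by simp) p) _

theorem along_sub {f g : PseudoEuclidean r s × V → G} (hf : ContDiff ℝ ∞ f) (hg : ContDiff ℝ ∞ g)
    (x p : PseudoEuclidean r s × V) :
    M.along x (fun q => f q - g q) p = M.along x f p - M.along x g p := by
  simp only [along]
  rw [fderiv_fun_sub (hf.differentiable (by simp) p) (hg.differentiable (by simp) p)]
  rfl

theorem along_const_smul {f : PseudoEuclidean r s × V → G} (hf : ContDiff ℝ ∞ f) (c : ℝ)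
    (x p : PseudoEuclidean r s × V) :
    M.along x (fun q => c • f q) p = c • M.along x f p := by
  simp only [along]
  rw [fderiv_fun_const_smul (hf.differentiable (by simp) p)]
  rfl

theorem along_prodMk {G' : Type*} [NormedAddCommGroup G'] [NormedSpace ℝ G']
    {f : PseudoEuclidean r s × V → G} {g : PseudoEuclidean r s × V → G'} (hf : ContDiff ℝ ∞ f)
    (hg : ContDiff ℝ ∞ g) (x p : PseudoEuclidean r s × V) :
    M.along x (fun q => (f q, g q)) p = (M.along x f p, M.along x g p) := by
  simp only [along]
  rw [(hf.differentiable (by simp) p).fderiv_prodMk (hg.differentiable (by simp) p)]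
  rfl

/-- The differential of `φ` in the left trivialization of the tangent bundle. -/
noncomputable def trivDeriv (φ : PseudoEuclidean r s × V → PseudoEuclidean r s × V)
    (p : PseudoEuclidean r s × V) : Module.End ℝ (PseudoEuclidean r s × V) where
  toFun x := ((M.along x φ p).1 - (1 / 2 : ℝ) • M.bracket (φ p).2 (M.along x φ p).2,
    (M.along x φ p).2)
  map_add' x y := by
    have h : M.along (x + y) φ p = M.along x φ p + M.along y φ p := by
      simp only [along]
      rw [← map_add]
      congr 1
      refine Prod.ext ?_ ?_
      · simp only [frame, Prod.fst_add, Prod.snd_add, map_add]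
        module
      · simp [frame]
    rw [h]
    refine Prod.ext ?_ ?_
    · simp only [Prod.fst_add, Prod.snd_add, map_add]
      module
    · simp
  map_smul' c x := by
    have h : M.along (c • x) φ p = c • M.along x φ p := by
      simp only [along]
      rw [← map_smul]
      congr 1
      refine Prod.ext ?_ ?_
      · simp only [frame, Prod.smul_fst, Prod.smul_snd, map_smul]
        module
      · simp [frame]
    rw [h]
    refine Prod.ext ?_ ?_
    · simp only [Prod.smul_fst, Prod.smul_snd, map_smul, RingHom.id_apply]
      module
    · simp

variable {M} {φ : PseudoEuclidean r s × V → PseudoEuclidean r s × V}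

theorem trivDeriv_apply (hφ : ContDiff ℝ ∞ φ) (p x : PseudoEuclidean r s × V) :
    M.trivDeriv φ p x = (M.along x (fun q => (φ q).1) p -
      (1 / 2 : ℝ) • M.bracket (φ p).2 (M.along x (fun q => (φ q).2) p),
      M.along x (fun q => (φ q).2) p) := by
  have h := M.along_prodMk (contDiff_fst.comp hφ) (contDiff_snd.comp hφ) x p
  change M.along x φ p = (M.along x (fun q => (φ q).1) p, M.along x (fun q => (φ q).2) p) at h
  change ((M.along x φ p).1 - (1 / 2 : ℝ) • M.bracket (φ p).2 (M.along x φ p).2,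
    (M.along x φ p).2) = _
  rw [h]

variable [FiniteDimensional ℝ V]

theorem contDiff_trivDeriv (hφ : ContDiff ℝ ∞ φ) (x : PseudoEuclidean r s × V) :
    ContDiff ℝ ∞ (fun p => M.trivDeriv φ p x) := by
  have h := M.contDiff_along x hφ
  exact ((contDiff_fst.comp h).sub ((contDiff_bilin M.bracket (contDiff_snd.comp hφ)
    (contDiff_snd.comp h)).const_smul (1 / 2 : ℝ))).prodMk (contDiff_snd.comp h)

theorem along_trivDeriv (hφ : ContDiff ℝ ∞ φ) (x y p : PseudoEuclidean r s × V) :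
    M.along x (fun q => M.trivDeriv φ q y) p =
      (M.along x (M.along y fun q => (φ q).1) p - (1 / 2 : ℝ) •
        (M.bracket (φ p).2 (M.along x (M.along y fun q => (φ q).2) p) +
          M.bracket (M.along x (fun q => (φ q).2) p) (M.along y (fun q => (φ q).2) p)),
        M.along x (M.along y fun q => (φ q).2) p) := by
  have h1 : ContDiff ℝ ∞ fun q => (φ q).1 := contDiff_fst.comp hφ
  have h2 : ContDiff ℝ ∞ fun q => (φ q).2 := contDiff_snd.comp hφ
  have h3 := M.contDiff_along y h1
  have h4 := M.contDiff_along y h2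
  have h5 := contDiff_bilin M.bracket h2 h4
  simp only [trivDeriv_apply hφ]
  rw [M.along_prodMk (h3.sub (h5.const_smul (1 / 2 : ℝ))) h4,
    M.along_sub h3 (h5.const_smul (1 / 2 : ℝ)), M.along_const_smul h5, M.along_bilin _ h2 h4]

/-- The compatibility of `φ` with the brackets of vector fields. -/
theorem along_trivDeriv_sub (hφ : ContDiff ℝ ∞ φ) (x y p : PseudoEuclidean r s × V) :
    M.along x (fun q => M.trivDeriv φ q y) p - M.along y (fun q => M.trivDeriv φ q x) p =
      M.trivDeriv φ p (M.lie x y) - M.lie (M.trivDeriv φ p x) (M.trivDeriv φ p y) := by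
  have h1 : ContDiff ℝ ∞ fun q => (φ q).1 := contDiff_fst.comp hφ
  have h2 : ContDiff ℝ ∞ fun q => (φ q).2 := contDiff_snd.comp hφ
  rw [along_trivDeriv hφ, along_trivDeriv hφ, trivDeriv_apply hφ p (M.lie x y),
    ← M.along_along_sub x y h1, ← M.along_along_sub x y h2]
  simp only [lie, trivDeriv_apply hφ]
  refine Prod.ext ?_ ?_
  · simp only [Prod.fst_sub, map_sub]
    rw [M.bracket_swap (M.along y (fun q => (φ q).2) p)]
    module
  · simp

theorem ip_trivDeriv
    (hiso : ∀ p u w, M.metric (φ p) (fderiv ℝ φ p u) (fderiv ℝ φ p w) = M.metric p u w)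
    (p x y : PseudoEuclidean r s × V) :
    M.ip (M.trivDeriv φ p x) (M.trivDeriv φ p y) = M.ip x y := by
  have h := hiso p (M.frame x p) (M.frame y p)
  rw [metric_eq, metric_eq] at h
  simp only [frame, add_sub_cancel_right] at h
  exact h

end Isometry
end AdmissibleModule

/-! ### Isometries act on the Lie algebra by isometric automorphisms -/

namespace AdmissibleModule

section Isometry

variable {r s : ℕ} {V : Type*} [NormedAddCommGroup V] [NormedSpace ℝ V] [FiniteDimensional ℝ V]
  {M : AdmissibleModule r s V} {φ : PseudoEuclidean r s × V → PseudoEuclidean r s × V}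

theorem trivDeriv_injective
    (hiso : ∀ p u w, M.metric (φ p) (fderiv ℝ φ p u) (fderiv ℝ φ p w) = M.metric p u w)
    (p : PseudoEuclidean r s × V) : Function.Injective (M.trivDeriv φ p) := by
  rw [← LinearMap.ker_eq_bot, LinearMap.ker_eq_bot']
  intro x hx
  refine M.eq_zero_of_ip fun y => ?_
  rw [← ip_trivDeriv hiso p, hx, map_zero, LinearMap.zero_apply]

theorem trivDeriv_surjective
    (hiso : ∀ p u w, M.metric (φ p) (fderiv ℝ φ p u) (fderiv ℝ φ p w) = M.metric p u w)
    (p : PseudoEuclidean r s × V) : Function.Surjective (M.trivDeriv φ p) :=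
  LinearMap.injective_iff_surjective.1 (trivDeriv_injective hiso p)

/-- An isometry preserves the Levi-Civita connection. -/
theorem along_trivDeriv_eq (hφ : ContDiff ℝ ∞ φ)
    (hiso : ∀ p u w, M.metric (φ p) (fderiv ℝ φ p u) (fderiv ℝ φ p w) = M.metric p u w)
    (x y p : PseudoEuclidean r s × V) :
    M.along x (fun q => M.trivDeriv φ q y) p = M.trivDeriv φ p (M.nabla x y) -
      M.nabla (M.trivDeriv φ p x) (M.trivDeriv φ p y) := by
  set A := M.trivDeriv φ p with hA
  -- The defect `D` is symmetric because both connections are torsion-free, and `⟨D x y, A z⟩` is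
  -- skew in `y, z` because both are metric. Cycling the arguments then forces `D = 0`, as in
  -- Koszul's argument.
  let D : PseudoEuclidean r s × V → PseudoEuclidean r s × V → PseudoEuclidean r s × V :=
    fun x y => M.along x (fun q => M.trivDeriv φ q y) p - (A (M.nabla x y) - M.nabla (A x) (A y))
  have hD : ∀ x y, D x y =
    M.along x (fun q => M.trivDeriv φ q y) p - (A (M.nabla x y) - M.nabla (A x) (A y)) :=
    fun _ _ => rfl
  have hsymm : ∀ x y, D x y = D y x := by
    intro x y
    have h := along_trivDeriv_sub (M := M) hφ x y p
    rw [← nabla_sub_nabla, ← nabla_sub_nabla, map_sub, ← hA] at h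
    rw [hD, hD]
    linear_combination (norm := abel) h
  have hskew : ∀ x y z, M.ip (D x y) (A z) = -M.ip (D x z) (A y) := by
    intro x y z
    have h1 := M.along_bilin M.ip (contDiff_trivDeriv (M := M) hφ y)
      (contDiff_trivDeriv (M := M) hφ z) x p
    simp only [ip_trivDeriv hiso] at h1
    have h2 : M.along x (fun _ : PseudoEuclidean r s × V => M.ip y z) p = 0 := by
      simp [along]
    rw [h2, ← hA, M.ip_comm (A y)] at h1
    have h3 : M.ip (A (M.nabla x y)) (A z) = -M.ip (A (M.nabla x z)) (A y) := by
      rw [ip_trivDeriv hiso, ip_trivDeriv hiso, ip_nabla, M.ip_comm y]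
    have h4 : M.ip (M.nabla (A x) (A y)) (A z) = -M.ip (M.nabla (A x) (A z)) (A y) := by
      rw [ip_nabla, M.ip_comm (A y)]
    simp only [hD, map_sub, LinearMap.sub_apply]
    linarith
  have hzero : D x y = 0 := by
    refine M.eq_zero_of_ip fun z' => ?_
    obtain ⟨z, rfl⟩ := trivDeriv_surjective hiso p z'
    rw [← hA]
    have e1 := hskew x y z
    have e2 := hskew z x y
    have e3 := hskew y z x
    rw [hsymm x z] at e1
    rw [hsymm z y] at e2
    rw [hsymm y x] at e3
    linarith
  exact sub_eq_zero.1 hzero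

/-- An isometry preserves the curvature tensor. -/
theorem trivDeriv_curvature (hφ : ContDiff ℝ ∞ φ)
    (hiso : ∀ p u w, M.metric (φ p) (fderiv ℝ φ p u) (fderiv ℝ φ p w) = M.metric p u w)
    (p x y z : PseudoEuclidean r s × V) :
    M.trivDeriv φ p (M.curvature x y z) =
      M.curvature (M.trivDeriv φ p x) (M.trivDeriv φ p y) (M.trivDeriv φ p z) := by
  -- The formula of `along_trivDeriv_eq`, differentiated once more; antisymmetrizing in `x, y`
  -- produces the curvature on both sides.
  have hsnd : ∀ x y, M.along x (M.along y fun q => M.trivDeriv φ q z) p =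
      M.trivDeriv φ p (M.nabla x (M.nabla y z)) -
        M.nabla (M.trivDeriv φ p x) (M.trivDeriv φ p (M.nabla y z)) -
      (M.nabla (M.trivDeriv φ p y) (M.trivDeriv φ p (M.nabla x z) -
        M.nabla (M.trivDeriv φ p x) (M.trivDeriv φ p z)) +
      M.nabla (M.trivDeriv φ p (M.nabla x y) -
        M.nabla (M.trivDeriv φ p x) (M.trivDeriv φ p y)) (M.trivDeriv φ p z)) := by
    intro x y
    have h1 : (M.along y fun q => M.trivDeriv φ q z) = fun q => M.trivDeriv φ q (M.nabla y z) -
        M.nabla (M.trivDeriv φ q y) (M.trivDeriv φ q z) :=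
      funext fun q => along_trivDeriv_eq hφ hiso y z q
    rw [h1, M.along_sub (contDiff_trivDeriv hφ _)
      (contDiff_bilin _ (contDiff_trivDeriv hφ _) (contDiff_trivDeriv hφ _)),
      M.along_bilin _ (contDiff_trivDeriv hφ _) (contDiff_trivDeriv hφ _)]
    simp only [along_trivDeriv_eq hφ hiso]
  have h := M.along_along_sub x y (contDiff_trivDeriv (M := M) hφ z) p
  rw [hsnd, hsnd, along_trivDeriv_eq hφ hiso] at h
  simp only [curvature, ← nabla_sub_nabla, map_sub, LinearMap.sub_apply] at h ⊢
  linear_combination (norm := abel) h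

/-- By invariance of the curvature, the two Jacobi operators are conjugate under `trivDeriv φ p`. -/
theorem trace_jacobi_trivDeriv (hφ : ContDiff ℝ ∞ φ)
    (hiso : ∀ p u w, M.metric (φ p) (fderiv ℝ φ p u) (fderiv ℝ φ p w) = M.metric p u w)
    (p x : PseudoEuclidean r s × V) :
    LinearMap.trace ℝ _ (M.jacobi (M.trivDeriv φ p x)) = LinearMap.trace ℝ _ (M.jacobi x) := by
  let e := LinearEquiv.ofBijective (M.trivDeriv φ p)
    ⟨trivDeriv_injective hiso p, trivDeriv_surjective hiso p⟩
  rw [← LinearMap.trace_conj' (M.jacobi x) e]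
  congr 1
  refine LinearMap.ext fun y' => ?_
  obtain ⟨y, rfl⟩ := e.surjective y'
  rw [LinearEquiv.conj_apply_apply, e.symm_apply_apply]
  exact (trivDeriv_curvature hφ hiso p y x x).symm

/-- An isometry preserves the central component of the scalar product. -/
theorem pseudoInner_trivDeriv [Nontrivial V] (hφ : ContDiff ℝ ∞ φ)
    (hiso : ∀ p u w, M.metric (φ p) (fderiv ℝ φ p u) (fderiv ℝ φ p w) = M.metric p u w)
    (p x y : PseudoEuclidean r s × V) :
    pseudoInner r s (M.trivDeriv φ p x).1 (M.trivDeriv φ p y).1 = pseudoInner r s x.1 y.1 := by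
  -- Eliminating the `V`-part between the invariance of the Ricci form and that of the metric leaves
  -- the central part multiplied by this number.
  have hpos : (0 : ℝ) < Module.finrank ℝ V / 4 + (r + s) / 2 := by
    have : (0 : ℝ) < Module.finrank ℝ V := by exact_mod_cast Module.finrank_pos
    positivity
  have hself : ∀ x, pseudoInner r s (M.trivDeriv φ p x).1 (M.trivDeriv φ p x).1 =
      pseudoInner r s x.1 x.1 := by
    intro x
    have h1 := trace_jacobi_trivDeriv hφ hiso p x
    rw [trace_jacobi, trace_jacobi] at h1
    have h2 := ip_trivDeriv hiso p x x
    rw [ip_apply, ip_apply] at h2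
    refine mul_left_cancel₀ hpos.ne' ?_
    linear_combination h1 + ((r + s) / 2 : ℝ) * h2
  have h := hself (x + y)
  simp only [map_add, Prod.fst_add, LinearMap.add_apply, hself] at h
  rw [pseudoInner_comm y.1 x.1, pseudoInner_comm (M.trivDeriv φ p y).1] at h
  linarith

theorem form_trivDeriv [Nontrivial V] (hφ : ContDiff ℝ ∞ φ)
    (hiso : ∀ p u w, M.metric (φ p) (fderiv ℝ φ p u) (fderiv ℝ φ p w) = M.metric p u w)
    (p x y : PseudoEuclidean r s × V) :
    M.form (M.trivDeriv φ p x).2 (M.trivDeriv φ p y).2 = M.form x.2 y.2 := by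
  have h1 := pseudoInner_trivDeriv hφ hiso p x y
  have h2 := ip_trivDeriv hiso p x y
  rw [ip_apply, ip_apply] at h2
  linarith

/-- `V` is the radical of the invariant form `⟨x.1, y.1⟩`, hence invariant. The center is treated
likewise in `trivDeriv_snd_eq_zero`. -/
theorem trivDeriv_fst_eq_zero [Nontrivial V] (hφ : ContDiff ℝ ∞ φ)
    (hiso : ∀ p u w, M.metric (φ p) (fderiv ℝ φ p u) (fderiv ℝ φ p w) = M.metric p u w)
    (p : PseudoEuclidean r s × V) (X : V) : (M.trivDeriv φ p (0, X)).1 = 0 := by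
  refine eq_zero_of_pseudoInner fun W => ?_
  obtain ⟨y, hy⟩ := trivDeriv_surjective hiso p (W, 0)
  have h := pseudoInner_trivDeriv hφ hiso p (0, X) y
  rw [hy] at h
  simpa using h

theorem trivDeriv_snd_eq_zero [Nontrivial V] (hφ : ContDiff ℝ ∞ φ)
    (hiso : ∀ p u w, M.metric (φ p) (fderiv ℝ φ p u) (fderiv ℝ φ p w) = M.metric p u w)
    (p : PseudoEuclidean r s × V) (Z : PseudoEuclidean r s) :
    (M.trivDeriv φ p (Z, 0)).2 = 0 := by
  refine M.form_nondegenerate.1 _ fun Y => ?_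
  obtain ⟨y, hy⟩ := trivDeriv_surjective hiso p (0, Y)
  have h := form_trivDeriv hφ hiso p (Z, 0) y
  rw [hy] at h
  simpa using h

/-- The differential of an isometry is compatible with the commutator. -/
theorem trivDeriv_bracket [Nontrivial V] (hφ : ContDiff ℝ ∞ φ)
    (hiso : ∀ p u w, M.metric (φ p) (fderiv ℝ φ p u) (fderiv ℝ φ p w) = M.metric p u w)
    (p : PseudoEuclidean r s × V) (X Y : V) :
    (M.trivDeriv φ p (M.bracket X Y, 0)).1 =
      M.bracket (M.trivDeriv φ p (0, X)).2 (M.trivDeriv φ p (0, Y)).2 := by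
  -- The central component vanishes identically, so does its derivative; the central part of
  -- `along_trivDeriv_eq` then compares half the brackets.
  have h1 : (fun q => M.trivDeriv φ q (0, Y)) = fun q => (0, (M.trivDeriv φ q (0, Y)).2) :=
    funext fun q => Prod.ext (trivDeriv_fst_eq_zero hφ hiso q Y) rfl
  have h2 := along_trivDeriv_eq hφ hiso (0, X) (0, Y) p
  have h6 : ContDiff ℝ ∞ fun q => (M.trivDeriv φ q (0, Y)).2 :=
    contDiff_snd.comp (contDiff_trivDeriv hφ _)
  rw [h1, M.along_prodMk contDiff_const h6] at h2
  have h3 := congrArg Prod.fst h2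
  have h4 : M.nabla (0, X) (0, Y) = (1 / 2 : ℝ) • (M.bracket X Y, 0) := by
    simp [nabla_apply]
  rw [h4, map_smul] at h3
  simp only [along, Prod.fst_sub, Prod.smul_fst, nabla_apply, fderiv_fun_const] at h3
  have h5 : (1 / 2 : ℝ) • ((M.trivDeriv φ p (M.bracket X Y, 0)).1 -
      M.bracket (M.trivDeriv φ p (0, X)).2 (M.trivDeriv φ p (0, Y)).2) = 0 := by
    rw [smul_sub]
    exact h3.symm
  exact sub_eq_zero.1 ((smul_eq_zero.1 h5).resolve_left (by norm_num))

/-- The differential of an isometry is compatible with the Clifford multiplication. -/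
theorem trivDeriv_J [Nontrivial V] (hφ : ContDiff ℝ ∞ φ)
    (hiso : ∀ p u w, M.metric (φ p) (fderiv ℝ φ p u) (fderiv ℝ φ p w) = M.metric p u w)
    (p : PseudoEuclidean r s × V) (Z : PseudoEuclidean r s) (X : V) :
    M.J (M.trivDeriv φ p (Z, 0)).1 (M.trivDeriv φ p (0, X)).2 =
      (M.trivDeriv φ p (0, M.J Z X)).2 := by
  rw [← sub_eq_zero]
  refine M.form_nondegenerate.1 _ fun Y' => ?_
  obtain ⟨⟨W, Y⟩, hy⟩ := trivDeriv_surjective hiso p (0, Y')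
  have hY : Y' = (M.trivDeriv φ p (0, Y)).2 := by
    have h : M.trivDeriv φ p (W, Y) = M.trivDeriv φ p (W, 0) + M.trivDeriv φ p (0, Y) := by
      rw [← map_add]; simp
    have h' := congrArg Prod.snd (h.symm.trans hy)
    rw [Prod.snd_add, trivDeriv_snd_eq_zero hφ hiso, zero_add] at h'
    exact h'.symm
  rw [map_sub, LinearMap.sub_apply, hY, ← pseudoInner_bracket, ← trivDeriv_bracket hφ hiso,
    pseudoInner_trivDeriv hφ hiso, form_trivDeriv hφ hiso]
  simp only
  rw [pseudoInner_bracket, sub_self]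

theorem triple_trivDeriv [Nontrivial V] (hφ : ContDiff ℝ ∞ φ)
    (hiso : ∀ p u w, M.metric (φ p) (fderiv ℝ φ p u) (fderiv ℝ φ p w) = M.metric p u w)
    (p : PseudoEuclidean r s × V) (X : V) (a b c : PseudoEuclidean r s) :
    M.triple (M.trivDeriv φ p (0, X)).2 (M.trivDeriv φ p (a, 0)).1 (M.trivDeriv φ p (b, 0)).1
      (M.trivDeriv φ p (c, 0)).1 = M.triple X a b c := by
  simp only [triple, trivDeriv_J hφ hiso, form_trivDeriv hφ hiso]

end Isometry
end AdmissibleModule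

theorem HasDerivAt.linearMap_bilin {A B C : Type*} [NormedAddCommGroup A] [NormedSpace ℝ A]
    [FiniteDimensional ℝ A] [NormedAddCommGroup B] [NormedSpace ℝ B] [FiniteDimensional ℝ B]
    [NormedAddCommGroup C] [NormedSpace ℝ C] (β : A →ₗ[ℝ] B →ₗ[ℝ] C)
    {f : ℝ → A} {g : ℝ → B} {f' : A} {g' : B} {t : ℝ}
    (hf : HasDerivAt f f' t) (hg : HasDerivAt g g' t) :
    HasDerivAt (fun q => β (f q) (g q)) (β (f t) g' + β f' (g t)) t := by
  simpa using (hf.hasFDerivAt.linearMap_bilin β hg.hasFDerivAt).hasDerivAt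

/-! ### Homogeneous geodesics and the obstruction -/

namespace AdmissibleModule

section GeodesicOrbit

variable {r s : ℕ} {V : Type*} [NormedAddCommGroup V] [NormedSpace ℝ V]
  {M : AdmissibleModule r s V} {φ : ℝ → PseudoEuclidean r s × V → PseudoEuclidean r s × V}

theorem trivDeriv_zero (φ : PseudoEuclidean r s × V → PseudoEuclidean r s × V)
    (x : PseudoEuclidean r s × V) : M.trivDeriv φ 0 x =
      ((fderiv ℝ φ 0 x).1 - (1 / 2 : ℝ) • M.bracket (φ 0).2 (fderiv ℝ φ 0 x).2,
        (fderiv ℝ φ 0 x).2) := by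
  have h : M.frame x 0 = x := by simp [frame]
  change ((M.along x φ 0).1 - (1 / 2 : ℝ) • M.bracket (φ 0).2 (M.along x φ 0).2,
    (M.along x φ 0).2) = _
  rw [along, h]

theorem contDiff_of_isOneParameterIsometryGroup (hφ : IsOneParameterIsometryGroup M.metric φ)
    (t : ℝ) : ContDiff ℝ ∞ (φ t) :=
  hφ.smooth.comp (contDiff_const.prodMk contDiff_id)

theorem trivDeriv_zero_zero (hφ : IsOneParameterIsometryGroup M.metric φ)
    (x : PseudoEuclidean r s × V) : M.trivDeriv (φ 0) 0 x = x := by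
  have h : φ 0 = id := funext hφ.zero
  rw [h, trivDeriv_zero]
  simp

/-- The velocity of an orbit of a one-parameter group is carried along by the group. -/
theorem fderiv_smul_deriv {γ : ℝ → PseudoEuclidean r s × V} {l : ℝ → ℝ}
    (hφ : IsOneParameterIsometryGroup M.metric φ) (hl : IsReparametrization l)
    (hγ : ContDiff ℝ ∞ γ) (h0 : γ 0 = 0) (horb : ∀ t, φ t 0 = γ (l t)) (t : ℝ) :
    fderiv ℝ (φ t) 0 (deriv l 0 • deriv γ 0) = deriv l t • deriv γ (l t) := by
  have hc : ∀ t, HasDerivAt (fun t => γ (l t)) (deriv l t • deriv γ (l t)) t := fun t =>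
    HasDerivAt.scomp t (hγ.differentiable (by simp) (l t)).hasDerivAt
      (hl.smooth.differentiable (by simp) t).hasDerivAt
  have h1 : HasDerivAt (fun u => φ t (γ (l u))) (fderiv ℝ (φ t) 0 (deriv l 0 • deriv γ 0)) 0 := by
    have h2 : HasFDerivAt (φ t) (fderiv ℝ (φ t) 0) (γ (l 0)) := by
      rw [hl.zero, h0]
      exact ((contDiff_of_isOneParameterIsometryGroup hφ t).differentiable (by simp) 0).hasFDerivAt
    have h3 := hc 0
    rw [hl.zero] at h3
    exact h2.comp_hasDerivAt 0 h3
  -- The group law: `φ_t` shifts the parameter of the orbit.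
  have h2 : (fun u => φ t (γ (l u))) = fun u => γ (l (t + u)) := by
    funext u
    rw [← horb, ← horb, hφ.add]
  rw [h2] at h1
  have h3 : HasDerivAt (fun u => γ (l (t + u))) (deriv l t • deriv γ (l t)) 0 := by
    have := hc (t + 0)
    rw [add_zero] at this
    exact HasDerivAt.comp_const_add t 0 (by rwa [add_zero])
  exact h1.unique h3

variable [FiniteDimensional ℝ V]

theorem fderiv_metric_zero (M : AdmissibleModule r s V)
    (u v w : PseudoEuclidean r s × V) :
    fderiv ℝ (fun q => M.metric q v w) 0 u =
      -(1 / 2 : ℝ) * (pseudoInner r s v.1 (M.bracket u.2 w.2) +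
        pseudoInner r s w.1 (M.bracket u.2 v.2)) := by
  have hd : ∀ v : PseudoEuclidean r s × V, ContDiff ℝ ∞
      fun q : PseudoEuclidean r s × V => M.bracket q.2 v.2 :=
    fun v => contDiff_bilin M.bracket contDiff_snd contDiff_const
  have h1 : ∀ v : PseudoEuclidean r s × V, ContDiff ℝ ∞
      fun q : PseudoEuclidean r s × V => v.1 - (1 / 2 : ℝ) • M.bracket q.2 v.2 :=
    fun v => contDiff_const.sub ((hd v).const_smul (1 / 2 : ℝ))
  have h2 : ∀ v : PseudoEuclidean r s × V,
      fderiv ℝ (fun q : PseudoEuclidean r s × V => v.1 - (1 / 2 : ℝ) • M.bracket q.2 v.2) 0 u =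
        -(1 / 2 : ℝ) • M.bracket u.2 v.2 := by
    intro v
    rw [fderiv_const_sub, fderiv_fun_const_smul ((hd v).differentiable (by simp) 0)]
    have h3 := fderiv_bilin M.bracket (f := fun q : PseudoEuclidean r s × V => q.2)
      (g := fun _ => v.2) (p := 0) differentiableAt_snd (differentiableAt_const _) u
    rw [neg_apply, smul_apply, h3, fderiv_snd]
    simp
  simp only [metric_eq]
  rw [fderiv_add_const, fderiv_bilin _ ((h1 v).differentiable (by simp) 0)
    ((h1 w).differentiable (by simp) 0), h2, h2, pseudoInner_comm _ (w.1 - _)]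
  simp only [Prod.snd_zero, map_zero, LinearMap.zero_apply, smul_zero, sub_zero, map_smul,
    smul_eq_mul]
  ring

theorem christoffelFirst_metric_zero (M : AdmissibleModule r s V)
    (v w : PseudoEuclidean r s × V) :
    christoffelFirst M.metric 0 v v w = -M.form (M.J v.1 v.2) w.2 := by
  simp only [christoffelFirst, fderiv_metric_zero, bracket_self, M.bracket_swap w.2, map_neg,
    map_zero]
  rw [pseudoInner_comm v.1, pseudoInner_bracket]
  ring

/-- The `V`-part of the geodesic equation at the identity. No other point is needed, since the orbit
condition is differentiated only at time zero. -/
theorem deriv_deriv_snd_of_isGeodesicCurve {γ : ℝ → PseudoEuclidean r s × V}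
    (hγ : IsGeodesicCurve M.metric γ) (h0 : γ 0 = 0) :
    (deriv (deriv γ) 0).2 = M.J (deriv γ 0).1 (deriv γ 0).2 := by
  rw [← sub_eq_zero]
  refine M.form_nondegenerate.1 _ fun Y => ?_
  have h := hγ.2 0 (0, Y)
  rw [h0, christoffelFirst_metric_zero, metric_zero, scalarProduct] at h
  simp only [map_zero, zero_add] at h
  rw [map_sub, LinearMap.sub_apply]
  linarith

theorem differentiable_trivDeriv (hφ : IsOneParameterIsometryGroup M.metric φ)
    (x : PseudoEuclidean r s × V) : Differentiable ℝ fun t => M.trivDeriv (φ t) 0 x := by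
  let Φ : ℝ × (PseudoEuclidean r s × V) → PseudoEuclidean r s × V := fun x => φ x.1 x.2
  have hΦ : ContDiff ℝ ∞ Φ := hφ.smooth
  have h1 : ∀ t, fderiv ℝ (φ t) 0 x = fderiv ℝ Φ (t, 0) (0, x) := by
    intro t
    have h2 : HasFDerivAt Φ (fderiv ℝ Φ (t, 0)) (t, 0) :=
      (hΦ.differentiable (by simp) _).hasFDerivAt
    have h3 : HasFDerivAt (fun q => (t, q))
        (ContinuousLinearMap.inr ℝ ℝ (PseudoEuclidean r s × V)) 0 := hasFDerivAt_prodMk_right t 0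
    have h4 : HasFDerivAt (φ t) ((fderiv ℝ Φ (t, 0)).comp
        (ContinuousLinearMap.inr ℝ ℝ (PseudoEuclidean r s × V))) 0 := h2.comp 0 h3
    rw [h4.fderiv]
    rfl
  have h2 : ContDiff ℝ ∞ fun t => fderiv ℝ (φ t) 0 x := by
    simp only [h1]
    exact ((hΦ.fderiv_right (m := ∞) (by simp)).comp
      (contDiff_id.prodMk contDiff_const)).clm_apply contDiff_const
  have h3 : ContDiff ℝ ∞ fun t => φ t 0 := hΦ.comp (contDiff_id.prodMk contDiff_const)
  have h4 : ContDiff ℝ ∞ fun t => M.trivDeriv (φ t) 0 x := by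
    simp only [trivDeriv_zero]
    exact ((contDiff_fst.comp h2).sub ((contDiff_bilin M.bracket (contDiff_snd.comp h3)
      (contDiff_snd.comp h2)).const_smul (1 / 2 : ℝ))).prodMk (contDiff_snd.comp h2)
  exact h4.differentiable (by simp)

/-- A geodesic orbit space gives, for the initial vector `(Z, X)`, a curve in the group of
isometric automorphisms whose velocity at the identity sends `X` to a vector proportional to `J_Z X`
modulo `X`. -/
theorem exists_hasDerivAt_trivDeriv [Nontrivial V] (hM : M.IsGeodesicOrbit)
    (Z : PseudoEuclidean r s) (X : V) :
    ∃ φ, IsOneParameterIsometryGroup M.metric φ ∧ ∃ k m : ℝ, m ≠ 0 ∧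
      HasDerivAt (fun t => (M.trivDeriv (φ t) 0 (0, X)).2) (k • X + m • M.J Z X) 0 := by
  obtain ⟨γ, hγ, h0, hξ, φ, l, hφ, hl, horb⟩ := hM (Z, X)
  rw [h0] at horb
  -- The `V`-part of `A_t X` is `l'(0)⁻¹ l'(t)` times that of `γ'(l t)`; the product and chain rules
  -- give `k = l''(0)/l'(0)` and `m = l'(0)`.
  refine ⟨φ, hφ, (deriv l 0)⁻¹ * deriv (deriv l) 0, deriv l 0, hl.deriv_ne_zero 0, ?_⟩
  have hsnd : ∀ t, (M.trivDeriv (φ t) 0 (0, X)).2 =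
      (deriv l 0)⁻¹ • deriv l t • (deriv γ (l t)).2 := by
    intro t
    have h1 := congrArg Prod.snd (fderiv_smul_deriv hφ hl hγ.1 h0 horb t)
    rw [map_smul, hξ, Prod.smul_snd, Prod.smul_snd] at h1
    rw [← h1, inv_smul_smul₀ (hl.deriv_ne_zero 0)]
    have h2 : M.trivDeriv (φ t) 0 (Z, X) =
        M.trivDeriv (φ t) 0 (Z, 0) + M.trivDeriv (φ t) 0 (0, X) := by
      rw [← map_add]; simp
    have h3 := congrArg Prod.snd h2
    rw [Prod.snd_add, trivDeriv_snd_eq_zero (contDiff_of_isOneParameterIsometryGroup hφ t)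
      (hφ.isometry t), zero_add, trivDeriv_zero _ (Z, X)] at h3
    exact h3.symm
  have hl' : HasDerivAt (deriv l) (deriv (deriv l) 0) 0 :=
    ((hl.smooth.iterate_deriv 1).differentiable (by simp) 0).hasDerivAt
  have hγ' : HasDerivAt (deriv γ) (deriv (deriv γ) (l 0)) (l 0) :=
    ((hγ.1.iterate_deriv 1).differentiable (by simp) _).hasDerivAt
  have h4 : HasDerivAt (fun t => deriv γ (l t)) (deriv l 0 • deriv (deriv γ) (l 0)) 0 :=
    HasDerivAt.scomp 0 hγ' (hl.smooth.differentiable (by simp) 0).hasDerivAt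
  have h5 : HasDerivAt (fun t => (deriv γ (l t)).2) (deriv l 0 • deriv (deriv γ) (l 0)).2 0 := by
    have := (hasFDerivAt_snd (𝕜 := ℝ) (p := deriv γ (l 0))).comp_hasDerivAt 0 h4
    exact this
  have h6 := (hl'.smul h5).const_smul (deriv l 0)⁻¹
  rw [hl.zero, Prod.smul_snd, deriv_deriv_snd_of_isGeodesicCurve hγ h0, hξ, smul_add,
    inv_smul_smul₀ (hl.deriv_ne_zero 0), smul_smul, add_comm] at h6
  simp only [hsnd]
  exact h6

/-- A pseudo `H`-type group is not geodesic orbit if the center contains eight orthonormal vectors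
with suitable signs. -/
theorem not_isGeodesicOrbit_of_signs [Nontrivial V] (f : Fin 8 → Fin r ⊕ Fin s)
    (hf : Function.Injective f)
    (h1 : basisSign (f 0) * basisSign (f 1) * basisSign (f 2) * basisSign (f 3) = 1)
    (h2 : basisSign (f 0) * basisSign (f 1) * basisSign (f 4) * basisSign (f 5) = 1)
    (h3 : basisSign (f 0) * basisSign (f 1) * basisSign (f 6) * basisSign (f 7) = 1)
    (h4 : basisSign (f 0) * basisSign (f 2) * basisSign (f 4) * basisSign (f 6) = 1) :
    ¬ M.IsGeodesicOrbit := by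
  intro hM
  obtain ⟨X, hX, hrad⟩ := M.exists_spinor f hf h1 h2 h3 h4
  obtain ⟨φ, hφ, k, m, hm, hd⟩ := exists_hasDerivAt_trivDeriv hM (Pi.single (f 0) 1) X
  have hb : ∀ a : PseudoEuclidean r s, ∃ a', HasDerivAt (fun t => (M.trivDeriv (φ t) 0 (a, 0)).1)
      a' 0 := by
    intro a
    have h := (differentiable_trivDeriv hφ (a, 0) 0).hasDerivAt
    have := (hasFDerivAt_fst (𝕜 := ℝ) (p := M.trivDeriv (φ 0) 0 (a, 0))).comp_hasDerivAt 0 h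
    exact ⟨_, this⟩
  set a : PseudoEuclidean r s := Pi.single (f 1) 1 with ha
  set b : PseudoEuclidean r s := Pi.single (f 2) 1 with hb'
  set c : PseudoEuclidean r s := Pi.single (f 3) 1 with hc
  obtain ⟨a', ha'⟩ := hb a
  obtain ⟨b', hb''⟩ := hb b
  obtain ⟨c', hc'⟩ := hb c
  have hder := ((ha'.linearMap_bilin M.J (hb''.linearMap_bilin M.J
    (hc'.linearMap_bilin M.J hd))).linearMap_bilin M.form hd)
  have hconst : (fun t => M.form (M.J (M.trivDeriv (φ t) 0 (a, 0)).1
      (M.J (M.trivDeriv (φ t) 0 (b, 0)).1 (M.J (M.trivDeriv (φ t) 0 (c, 0)).1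
        (M.trivDeriv (φ t) 0 (0, X)).2))) (M.trivDeriv (φ t) 0 (0, X)).2) =
      fun _ => M.triple X a b c :=
    funext fun t => triple_trivDeriv (contDiff_of_isOneParameterIsometryGroup hφ t)
      (hφ.isometry t) 0 X a b c
  rw [hconst] at hder
  have hzero := hder.unique (hasDerivAt_const 0 _)
  simp only [trivDeriv_zero_zero hφ, map_add, map_smul, LinearMap.add_apply,
    LinearMap.smul_apply, smul_eq_mul] at hzero
  have r23 : ∀ w, M.triple X w b c = 0 := hrad 2 (by decide) 3 (by decide) (by decide)
  have r13 : ∀ w, M.triple X w a c = 0 := hrad 1 (by decide) 3 (by decide) (by decide)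
  have r12 : ∀ w, M.triple X w a b = 0 := hrad 1 (by decide) 2 (by decide) (by decide)
  -- The terms in which a central vector moves: alternation brings the moving vector to the first
  -- slot, leaving two of `a, b, c` in the others.
  have t0 : M.form (M.J a (M.J b (M.J c X))) X = 0 := r23 a
  have t1 : M.form (M.J a' (M.J b (M.J c X))) X = 0 := r23 a'
  have t2 : M.form (M.J a (M.J b' (M.J c X))) X = 0 :=
    (M.triple_swap_left X a b' c).trans (by rw [r13, neg_zero])
  have t3 : M.form (M.J a (M.J b (M.J c' X))) X = 0 :=
    (M.triple_swap_right X a b c').trans (by rw [triple_swap_left, r12, neg_zero, neg_zero])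
  -- The two terms in which `X` moves carry the same sign, one from skewness of `J` and one from
  -- three anticommutations, so they add instead of cancelling.
  have q1 : M.form (M.J a (M.J b (M.J c X))) (M.J (Pi.single (f 0) 1) X) =
      -M.form (M.quad (f 0) (f 1) (f 2) (f 3) X) X := by
    have := M.form_J (Pi.single (f 0) 1) (M.J a (M.J b (M.J c X))) X
    change _ = -M.form (M.J (Pi.single (f 0) 1) (M.J a (M.J b (M.J c X)))) X
    linarith
  have q2 : M.form (M.J a (M.J b (M.J c (M.J (Pi.single (f 0) 1) X)))) X =
      -M.form (M.quad (f 0) (f 1) (f 2) (f 3) X) X := by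
    change M.form (M.gen (f 1) (M.gen (f 2) (M.gen (f 3) (M.gen (f 0) X)))) X =
      -M.form (M.gen (f 0) (M.gen (f 1) (M.gen (f 2) (M.gen (f 3) X)))) X
    rw [M.gen_gen_of_ne (hf.ne (by decide : (3 : Fin 8) ≠ 0)), map_neg,
      M.gen_gen_of_ne (hf.ne (by decide : (2 : Fin 8) ≠ 0)), neg_neg,
      M.gen_gen_of_ne (hf.ne (by decide : (1 : Fin 8) ≠ 0)), map_neg, LinearMap.neg_apply]
  rw [t0, t1, t2, t3, q1, q2] at hzero
  have : m * M.form (M.quad (f 0) (f 1) (f 2) (f 3) X) X = 0 := by linarith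
  exact (mul_ne_zero hm hX) this

end GeodesicOrbit
end AdmissibleModule

/-- In the center of `N_{r+μ,s+ν}` there are always eight basis vectors with the signs required by
`AdmissibleModule.not_isGeodesicOrbit_of_signs`, whatever `N_{r,s}` is. Thus no pseudo `H`-type
group `N_{r+μ,s+ν}` is geodesic orbit, and the hypothesis on `N_{r,s}` is not used. -/
theorem mainTheorem8 (r s μ ν : ℕ)
    (hμν : (μ, ν) = (8, 0) ∨ (μ, ν) = (0, 8) ∨ (μ, ν) = (4, 4))
    {V : Type*} [NormedAddCommGroup V] [NormedSpace ℝ V] [FiniteDimensional ℝ V]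
    {W : Type*} [NormedAddCommGroup W] [NormedSpace ℝ W] [FiniteDimensional ℝ W]
    (M : AdmissibleModule r s V) (hM : M.IsMinimal)
    (M' : AdmissibleModule (r + μ) (s + ν) W) (hM' : M'.IsMinimal)
    (hGO : ¬ M.IsGeodesicOrbit) : ¬ M'.IsGeodesicOrbit := by
  have : Nontrivial W := hM'.1
  rcases hμν with h | h | h <;> obtain ⟨rfl, rfl⟩ := Prod.mk.injEq .. ▸ h
  · refine AdmissibleModule.not_isGeodesicOrbit_of_signs
      (fun i => Sum.inl (Fin.natAdd r i)) (fun i j hij => ?_) ?_ ?_ ?_ ?_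
    · simpa using hij
    all_goals simp [AdmissibleModule.basisSign]
  · refine AdmissibleModule.not_isGeodesicOrbit_of_signs
      (fun i => Sum.inr (Fin.natAdd s i)) (fun i j hij => ?_) ?_ ?_ ?_ ?_
    · simpa using hij
    all_goals simp [AdmissibleModule.basisSign]
  -- Indices below 4 are positive and the others negative; each of 0123, 0145, 0167, 0246 contains
  -- an even number of negative ones.
  · have hsign : ∀ i : Fin (4 + 4), AdmissibleModule.basisSign
        (Sum.map (Fin.natAdd r) (Fin.natAdd s) (finSumFinEquiv.symm i)) =
          if i.val < 4 then 1 else -1 := by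
      intro i
      refine Fin.addCases (fun j => ?_) (fun j => ?_) i
      · rw [finSumFinEquiv_symm_apply_castAdd]
        simp [AdmissibleModule.basisSign]
      · rw [finSumFinEquiv_symm_apply_natAdd]
        simp [AdmissibleModule.basisSign]
    refine AdmissibleModule.not_isGeodesicOrbit_of_signs
      (fun i : Fin (4 + 4) => Sum.map (Fin.natAdd r) (Fin.natAdd s) (finSumFinEquiv.symm i))
      (fun i j hij => ?_) ?_ ?_ ?_ ?_
    · exact finSumFinEquiv.symm.injective
        (Sum.map_injective.2 ⟨Fin.natAdd_injective _ _, Fin.natAdd_injective _ _⟩ hij)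
    all_goals simp [hsign]
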